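/- Let $q\ge 2$ be a prime power, let $V$ be a unitary space of dimension $n$ over $\mathrm{GF}(q^2)$, i.e. an $n$-dimensional vector space equipped with a non-degenerate Hermitian form with respect to the automorphism $x\mapsto x^q$ of order $2$, and let $\Bbbk$ be a field of characteristic $0$. Let $\mathcal F(V)$ be the frame complex of $V$: the simplicial complex whose vertices are the non-degenerate $1$-dimensional subspaces of $V$ and whose simplices are the sets of pairwise orthogonal vertices. Call a simplicial complex $\mathcal K$ *$\Bbbk$-homologically $m$-connected* if its reduced homology satisfies $\tilde H_i(\mathcal K;\Bbbk)=0$ for all $-1\le i\le m$ (so that $\mathcal K\neq\emptyset$ if $m\ge -1$). Then: (i) If $2\le n<q+1$, then $\mathcal F(V)$ is $\Bbbk$-homologically $(n-3)$-connected. (ii) If $q\ge 3$ and $4\le n<q^2-q+4$, then $\mathcal F(V)$ is $\Bbbk$-homologically $(n-4)$-connected. (iii) If $q\ge 3$ and $n\ge 4$, then: (a) if $n\in\{4,5,6\}$ and $n\le q$, then $\mathcal F(V)$ is $\Bbbk$-homologically $(n-3)$-connected; (b) if $n\in\{4,5,6\}$ and $q<n$, then $\mathcal F(V)$ is $\Bbbk$-homologically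 $(n-4)$-connected; (c) if $n\ge 7$, then $\mathcal F(V)$ is $\Bbbk$-homologically $[n/2]$-connected, where $[n/2]$ is the integer part of $n/2$. -/

import Mathlib

/-- The quotient `Z / (B ∩ Z)` of submodules of a module. -/
abbrev Submodule.Subquotient {R M : Type*} [Ring R] [AddCommGroup M] [Module R M]
    (Z B : Submodule R M) : Type _ :=
  Z ⧸ B.submoduleOf Z

/-! ### Reduced simplicial homology of an abstract simplicial complex -/

namespace AbstractSimplicialComplex

section Homology

variable {α : Type*} (k : Type*) [CommRing k]

/-- The module of reduced simplicial chains of `X` on simplices with exactly `r` vertices, that is,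
of dimension `r - 1`. The empty simplex is included, so the chains with `r = 0` are the
augmentation term in degree `-1`. Chains are formal linear combinations of vertex sets. -/
def chains (X : AbstractSimplicialComplex α) (r : ℕ) : Submodule k (Finset α →₀ k) :=
  Finsupp.supported k k {s : Finset α | s.card = r ∧ (s = ∅ ∨ s ∈ X)}

variable [LinearOrder α]

/-- The sign `(-1)^j` of a vertex `v` of `s`, where `v` is the `j`-th smallest vertex of `s`,
counting from `0`. -/
def vertexSign (s : Finset α) (v : α) : k :=
  (-1) ^ (s.filter (· < v)).card

/-- The simplicial boundary map
`∂ [v₀ < ⋯ < vₘ] = ∑ⱼ (-1)^j [v₀, …, v̂ⱼ, …, vₘ]`. In particular `∂ [v] = ∅` for a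
vertex `v` (the augmentation) and `∂ ∅ = 0`. -/
noncomputable def boundary : (Finset α →₀ k) →ₗ[k] (Finset α →₀ k) :=
  Finsupp.lsum k fun s =>
    LinearMap.toSpanSingleton k _ (∑ v ∈ s, Finsupp.single (s.erase v) (vertexSign k s v))

theorem boundary_single (s : Finset α) (a : k) :
    boundary k (Finsupp.single s a) =
      a • ∑ v ∈ s, Finsupp.single (s.erase v) (vertexSign k s v) := by
  simp [boundary]

theorem vertexSign_erase_of_lt {s : Finset α} {v w : α} (hv : v ∈ s) (h : v < w) :
    vertexSign k (s.erase v) w = - vertexSign k s w := by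
  unfold vertexSign
  have hm : v ∈ s.filter (· < w) := by simp [hv, h]
  rw [Finset.filter_erase, ← Finset.card_erase_add_one hm, pow_succ]
  ring

theorem vertexSign_erase_of_gt {s : Finset α} {v w : α} (h : w < v) :
    vertexSign k (s.erase v) w = vertexSign k s w := by
  unfold vertexSign
  rw [Finset.filter_erase, Finset.erase_eq_of_notMem]
  simp [h.le]

theorem boundary_boundary (c : Finset α →₀ k) : boundary k (boundary k c) = 0 := by
  induction c using Finsupp.induction_linear with
  | zero => simp
  | add f g hf hg => simp [hf, hg]
  | single s a =>
    rw [boundary_single, map_smul, map_sum]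
    simp only [boundary_single, Finset.smul_sum, Finsupp.smul_single, smul_eq_mul]
    rw [Finset.sum_sigma']
    refine Finset.sum_involution (fun p _ => ⟨p.2, p.1⟩) ?_ ?_ ?_ ?_
    · rintro ⟨v, w⟩ hp
      simp only [Finset.mem_sigma, Finset.mem_erase] at hp
      obtain ⟨hv, hwv, hw⟩ := hp
      dsimp only
      rw [Finset.erase_right_comm (a := w) (b := v), ← Finsupp.single_add]
      rcases lt_or_gt_of_ne hwv with h | h
      · rw [vertexSign_erase_of_gt k h, vertexSign_erase_of_lt k hw h]
        simp [mul_comm]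
      · rw [vertexSign_erase_of_gt k h, vertexSign_erase_of_lt k hv h]
        simp [mul_comm]
    · rintro ⟨v, w⟩ hp _ h
      simp only [Finset.mem_sigma, Finset.mem_erase] at hp
      exact hp.2.1 (by simpa using congrArg Sigma.fst h)
    · rintro ⟨v, w⟩ hp
      simp only [Finset.mem_sigma, Finset.mem_erase] at hp ⊢
      exact ⟨hp.2.2, hp.2.1.symm, hp.1⟩
    · rintro ⟨v, w⟩ _
      rfl

/-- Cycles among the reduced chains on `r` vertices. -/
noncomputable def cycles (X : AbstractSimplicialComplex α) (r : ℕ) :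
    Submodule k (Finset α →₀ k) :=
  chains k X r ⊓ LinearMap.ker (boundary k)

/-- Boundaries of the reduced chains on `r + 1` vertices. -/
noncomputable def boundaries (X : AbstractSimplicialComplex α) (r : ℕ) :
    Submodule k (Finset α →₀ k) :=
  (chains k X (r + 1)).map (boundary k)

theorem boundary_mem_chains (X : AbstractSimplicialComplex α) (r : ℕ) {c : Finset α →₀ k}
    (hc : c ∈ chains k X (r + 1)) : boundary k c ∈ chains k X r := by
  have key : chains k X (r + 1) ≤ (chains k X r).comap (boundary k) := by
    rw [chains, Finsupp.supported_eq_span_single, Submodule.span_le]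
    rintro _ ⟨s, ⟨hs, hX⟩, rfl⟩
    have hsX : s ∈ X := hX.resolve_left (by rintro rfl; simp at hs)
    simp only [Submodule.comap_coe, Set.mem_preimage, SetLike.mem_coe, boundary_single, one_smul]
    refine Submodule.sum_mem _ fun v hv => ?_
    refine Finsupp.single_mem_supported k _ ⟨?_, ?_⟩
    · rw [Finset.card_erase_of_mem hv, hs]; rfl
    · rcases (s.erase v).eq_empty_or_nonempty with h | h
      · exact Or.inl h
      · exact Or.inr ((X.isRelLowerSet_faces hsX).2 (Finset.erase_subset v s) h)
  exact key hc

/-- Boundaries are cycles, so the quotient in `reducedHomology` is by all boundaries. -/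
theorem boundaries_le_cycles (X : AbstractSimplicialComplex α) (r : ℕ) :
    boundaries k X r ≤ cycles k X r := by
  rintro _ ⟨c, hc, rfl⟩
  exact ⟨boundary_mem_chains k X r hc, boundary_boundary k c⟩

/-- The reduced simplicial homology of `X` with coefficients in `k` in degree `r - 1`:
cycles on `r` vertices modulo boundaries of chains on `r + 1` vertices. -/
abbrev reducedHomology (X : AbstractSimplicialComplex α) (r : ℕ) : Type _ :=
  Submodule.Subquotient (cycles k X r) (boundaries k X r)

end Homology

/-- `X` is `k`-homologically `m`-connected: its reduced homology with coefficients in `k` vanishes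
in all degrees `i ≤ m`. Degree `i = -1` is included, so for `m ≥ -1` the complex is nonempty.
Here `i = r - 1`. The linear order on the vertices only serves to orient the simplices; up to
isomorphism the homology does not depend on it. -/
def IsHomologicallyConnected {α : Type*} (k : Type*) [CommRing k] (X : AbstractSimplicialComplex α)
    (m : ℤ) : Prop :=
  ∀ _ : LinearOrder α, ∀ r : ℕ, (r : ℤ) - 1 ≤ m → Subsingleton (reducedHomology k X r)

end AbstractSimplicialComplex

/-- The clique complex of a graph: its simplices are the nonempty finite cliques. -/
def SimpleGraph.cliqueComplex {α : Type*} (G : SimpleGraph α) : AbstractSimplicialComplex α where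
  faces := {s | s.Nonempty ∧ G.IsClique (s : Set α)}
  isRelLowerSet_faces := fun _ hs =>
    ⟨hs.1, fun _ hts ht => ⟨ht, hs.2.subset (Finset.coe_subset.mpr hts)⟩⟩
  singleton_mem v := ⟨Finset.singleton_nonempty v, by simp⟩

/-! ### Unitary spaces and the frame complex -/

/-- A unitary structure on a vector space `V` over a field `K` with respect to `τ`: here `τ` is an
automorphism of `K` of order `2`, and `form` is a nondegenerate Hermitian form, linear in the first
and `τ`-semilinear in the second argument. -/
structure UnitaryForm {K : Type*} [Field K] (τ : K →+* K) (V : Type*) [AddCommGroup V]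
    [Module K V] where
  involutive : ∀ x, τ (τ x) = x
  ne_id : τ ≠ RingHom.id K
  form : V →ₗ[K] V →ₛₗ[τ] K
  hermitian : ∀ v w, form v w = τ (form w v)
  nondegenerate : form.Nondegenerate

namespace UnitaryForm

variable {K : Type*} [Field K] {τ : K →+* K} {V : Type*} [AddCommGroup V] [Module K V]
  (Ψ : UnitaryForm τ V)

/-- A subspace is nondegenerate if its radical (the vectors of `S` orthogonal to all of `S`)
is zero. -/
def IsNondegenerateSubspace (S : Submodule K V) : Prop :=
  ∀ v ∈ S, (∀ w ∈ S, Ψ.form v w = 0) → v = 0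

/-- The nondegenerate `1`-dimensional subspaces of `V`. -/
def NondegenerateLine : Type _ :=
  {S : Submodule K V // Module.finrank K S = 1 ∧ Ψ.IsNondegenerateSubspace S}

/-- The graph on the nondegenerate `1`-dimensional subspaces of `V` in which two distinct
subspaces are adjacent if and only if they are orthogonal. -/
def orthogonalityGraph : SimpleGraph Ψ.NondegenerateLine where
  Adj S T := S ≠ T ∧ ∀ v ∈ S.1, ∀ w ∈ T.1, Ψ.form v w = 0
  symm := ⟨fun _ _ h => ⟨h.1.symm, fun v hv w hw => by
    rw [Ψ.hermitian, h.2 w hw v hv, map_zero]⟩⟩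
  loopless := ⟨fun _ h => h.1 rfl⟩

/-- The frame complex: the clique complex of the orthogonality graph. Its simplices are the
nonempty partial frames. -/
def frameComplex : AbstractSimplicialComplex Ψ.NondegenerateLine :=
  Ψ.orthogonalityGraph.cliqueComplex

end UnitaryForm

/-! The proof is Garland's method. Fix the degree `r - 1` and write `n = r + (l + 1)`. For a cochain
`x` on the faces with `r` vertices, the squared norm of its coboundary splits into a diagonal part,
where every face is weighted by its number of cofaces, and a cross part, which is minus the sum of
the adjacency forms of the links of the faces `t` with `r - 1` vertices, evaluated at the
localisations of `x`. If every degree is at least `d` and the adjacency form of every link is at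
most `b / a` off the constants, then `(a * d - b * r) ‖x‖² ≤ a ‖δx‖² + c ‖∂x‖²`; the constant
components of the localisations are paid for by `∂x`. So `b * r < a * d` makes an integral Laplacian
definite, and its nonzero determinant stays nonzero in every field of characteristic `0`.

In the frame complex the link of `t` is the frame complex of the nondegenerate space `t^⊥`, of
dimension `l + 2`. A face with `r` vertices lies in `q^l (q^(l+1) - (-1)^(l+1)) / (q + 1)` cofaces,
the number of nondegenerate lines in dimension `l + 1`. Counting common orthogonal vectors of two
lines bounds the adjacency form of the links by `q^l` off the constants. Homology therefore vanishes
in degree `r - 1` once `r (q + 1) < q^(l+1) - (-1)^(l+1)`, and all the ranges of the theorem follow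
from this inequality. -/

/-! ### Exactness from a definite integral Laplacian -/

/-- If `A * B = 0` for integer matrices and the Laplacian form `a ‖Bᵀ x‖² + c ‖A x‖²` is definite,
then the complex given by `B` and `A` is exact over every field of characteristic zero. -/
theorem Matrix.exists_mulVec_eq_of_laplacian_definite {S T U : Type*} [Fintype S] [Fintype T]
    [Fintype U] (A : Matrix T S ℤ) (B : Matrix S U ℤ) (hAB : A * B = 0) (a c : ℤ)
    (hdef : ∀ x : S → ℤ, a * (B.transpose.mulVec x ⬝ᵥ B.transpose.mulVec x) +
      c * (A.mulVec x ⬝ᵥ A.mulVec x) = 0 → x = 0)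
    {k : Type*} [Field k] [CharZero k] (z : S → k)
    (hz : (A.map (Int.cast : ℤ → k)).mulVec z = 0) :
    ∃ w : U → k, (B.map (Int.cast : ℤ → k)).mulVec w = z := by
  classical
  -- Positivity has no meaning over `k`, so the Laplacian is shown nonsingular over `ℤ` and only its
  -- determinant is carried to `k`.
  set M : Matrix S S ℤ := a • (B * B.transpose) + c • (A.transpose * A) with hM
  have hdet : M.det ≠ 0 := by
    intro h
    obtain ⟨x, hx0, hx⟩ := Matrix.exists_mulVec_eq_zero_iff.2 h
    refine hx0 (hdef x ?_)
    have h1 : x ⬝ᵥ M.mulVec x = 0 := by rw [hx, dotProduct_zero]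
    rw [hM, Matrix.add_mulVec, dotProduct_add, Matrix.smul_mulVec, Matrix.smul_mulVec,
      dotProduct_smul, dotProduct_smul, ← Matrix.mulVec_mulVec, ← Matrix.mulVec_mulVec,
      Matrix.dotProduct_mulVec x B, Matrix.dotProduct_mulVec x A.transpose,
      Matrix.vecMul_transpose, ← Matrix.mulVec_transpose, smul_eq_mul, smul_eq_mul] at h1
    exact h1
  set A' := A.map (Int.cast : ℤ → k) with hA'
  set B' := B.map (Int.cast : ℤ → k) with hB'
  set M' := M.map (Int.cast : ℤ → k) with hM'
  have hdet' : M'.det ≠ 0 := by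
    have : M'.det = ((M.det : ℤ) : k) := (RingHom.map_det (Int.castRingHom k) M).symm
    rw [this]
    exact_mod_cast hdet
  have hAB' : A' * B' = 0 := by
    have := congrArg (fun N : Matrix T U ℤ => N.map (Int.castRingHom k)) hAB
    simp only [Matrix.map_mul] at this
    rw [hA', hB']
    simpa using this
  have hMe : M' = (a : k) • (B' * B'.transpose) + (c : k) • (A'.transpose * A') := by
    ext i j
    simp only [hM', hM, hA', hB', Matrix.mul_apply, Matrix.map_apply, Matrix.add_apply,
      Matrix.smul_apply, Matrix.transpose_apply, smul_eq_mul]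
    push_cast
    rfl
  have hinj : Function.Injective M'.mulVec :=
    Matrix.mulVec_injective_of_isUnit ((Matrix.isUnit_iff_isUnit_det _).2 hdet'.isUnit)
  have happ : ∀ x, A'.mulVec x = 0 → M'.mulVec x = B'.mulVec ((a : k) • B'.transpose.mulVec x) := by
    intro x hx
    rw [hMe, Matrix.add_mulVec, Matrix.smul_mulVec, Matrix.smul_mulVec, ← Matrix.mulVec_mulVec,
      ← Matrix.mulVec_mulVec, hx, Matrix.mulVec_zero, smul_zero, add_zero, Matrix.mulVec_smul]
  -- On `ker A'` the Laplacian is a multiple of `B' B'ᵀ`, so it maps `ker A'` into the range of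
  -- `B'`, hence into itself. Being injective there, it is onto in finite dimension, and every `z`
  -- in `ker A'` lies in the range of `B'`.
  let Z : Submodule k (S → k) := LinearMap.ker (Matrix.mulVecLin A')
  have hmaps : ∀ x ∈ Z, Matrix.mulVecLin M' x ∈ Z := by
    intro x hx
    have hx' : A'.mulVec x = 0 := by simpa [Z] using hx
    simp only [Z, LinearMap.mem_ker, Matrix.mulVecLin_apply]
    rw [happ x hx', Matrix.mulVec_mulVec, hAB', Matrix.zero_mulVec]
  let f : Z →ₗ[k] Z := (Matrix.mulVecLin M').restrict hmaps
  have hf : Function.Injective f := by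
    intro x y hxy
    exact Subtype.ext (hinj (by simpa [f] using congrArg Subtype.val hxy))
  obtain ⟨y, hy⟩ := LinearMap.injective_iff_surjective.1 hf ⟨z, by simpa [Z] using hz⟩
  have hy' : A'.mulVec y.1 = 0 := y.2
  refine ⟨_, (happ y.1 hy').symm.trans ?_⟩
  simpa [f] using congrArg Subtype.val hy

/-! ### Garland's method for simplicial complexes -/

namespace AbstractSimplicialComplex

variable {α : Type*}

/-- A vertex set which is a simplex or empty. -/
def IsFace (X : AbstractSimplicialComplex α) (s : Finset α) : Prop := s = ∅ ∨ s ∈ X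

theorem IsFace.subset {X : AbstractSimplicialComplex α} {s t : Finset α} (hs : X.IsFace s)
    (hts : t ⊆ s) : X.IsFace t := by
  rcases t.eq_empty_or_nonempty with h | h
  · exact Or.inl h
  · rcases hs with rfl | hs
    · exact Or.inl (Finset.subset_empty.1 hts)
    · exact Or.inr ((X.isRelLowerSet_faces hs).2 hts h)

theorem vertexSign_mul_self [LinearOrder α] (s : Finset α) (v : α) :
    vertexSign ℤ s v * vertexSign ℤ s v = 1 := by
  unfold vertexSign
  rw [← mul_pow]; simp

/-- The down- and up-Laplacian have opposite off-diagonal signs. -/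
theorem vertexSign_mul_vertexSign [LinearOrder α] {t : Finset α} {v w : α} (hvw : v ≠ w) (hv : v ∉ t)
    (hw : w ∉ t) :
    vertexSign ℤ (insert v (insert w t)) v * vertexSign ℤ (insert v (insert w t)) w =
      -(vertexSign ℤ (insert v t) v * vertexSign ℤ (insert w t) w) := by
  set u := insert v (insert w t) with hu
  have h1 : u.erase v = insert w t := by
    rw [hu, Finset.erase_insert (by simp [hvw, hv])]
  have h2 : u.erase w = insert v t := by
    rw [hu, Finset.insert_comm, Finset.erase_insert (by simp [hvw.symm, hw])]
  have hvu : v ∈ u := by simp [hu]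
  have hwu : w ∈ u := by simp [hu]
  rw [← h1, ← h2]
  rcases lt_or_gt_of_ne hvw with h | h
  · rw [vertexSign_erase_of_gt ℤ h, vertexSign_erase_of_lt ℤ hvu h]; ring
  · rw [vertexSign_erase_of_gt ℤ h, vertexSign_erase_of_lt ℤ hwu h]; ring

section Garland

variable [LinearOrder α] [Fintype α]

open Classical in
theorem sum_faces_erase (X : AbstractSimplicialComplex α) (r : ℕ) (g : Finset α → ℤ) :
    ∑ u with u.card = r + 1 ∧ X.IsFace u, ∑ v ∈ u, g (u.erase v) =
      ∑ s with s.card = r, ∑ v with v ∉ s ∧ X.IsFace (insert v s), g s := by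
  rw [Finset.sum_sigma', Finset.sum_sigma']
  refine Finset.sum_bij' (fun p _ => ⟨p.1.erase p.2, p.2⟩) (fun p _ => ⟨insert p.2 p.1, p.2⟩)
    ?_ ?_ ?_ ?_ ?_
  · rintro ⟨u, v⟩ h
    simp only [Finset.mem_sigma, Finset.mem_filter, Finset.mem_univ, true_and] at h ⊢
    simp [Finset.card_erase_of_mem h.2, h.1.1, Finset.insert_erase h.2, h.1.2]
  · rintro ⟨s, v⟩ h
    simp only [Finset.mem_sigma, Finset.mem_filter, Finset.mem_univ, true_and] at h ⊢
    simp [Finset.card_insert_of_notMem h.2.1, h.1, h.2.2]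
  · rintro ⟨u, v⟩ h
    simp only [Finset.mem_sigma] at h
    simp [Finset.insert_erase h.2]
  · rintro ⟨s, v⟩ h
    simp only [Finset.mem_sigma, Finset.mem_filter, Finset.mem_univ, true_and] at h
    simp [Finset.erase_insert h.2.1]
  · rintro ⟨u, v⟩ h
    rfl

-- Regroups the cross terms of the squared coboundary by `t = u \ {v, w}`, so that they become sums
-- over edges of the link of `t`. Writing `t.card + 1 = r` leaves no `t` at all when `r = 0`, which
-- lets degree `-1` be treated like the others.
open Classical in
theorem sum_faces_pairs (X : AbstractSimplicialComplex α) (r : ℕ) (h : Finset α → α → α → ℤ) :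
    ∑ u with u.card = r + 1 ∧ X.IsFace u, ∑ v ∈ u, ∑ w ∈ u.erase v, h u v w =
      ∑ t with t.card + 1 = r, ∑ v, ∑ w with (v ≠ w ∧ v ∉ t ∧ w ∉ t ∧
        X.IsFace (insert v (insert w t))), h (insert v (insert w t)) v w := by
  simp only [Finset.sum_sigma']
  refine Finset.sum_bij' (fun p _ => ⟨(p.1.erase p.2.1).erase p.2.2, p.2⟩)
    (fun p _ => ⟨insert p.2.1 (insert p.2.2 p.1), p.2⟩) ?_ ?_ ?_ ?_ ?_
  · rintro ⟨u, v, w⟩ H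
    simp only [Finset.mem_sigma, Finset.mem_filter, Finset.mem_univ, true_and] at H ⊢
    obtain ⟨⟨h1, h2⟩, hv, hw⟩ := H
    have hv' := hw
    rw [Finset.mem_erase] at hv'
    refine ⟨?_, hv'.1.symm, by simp, by simp, ?_⟩
    · have := Finset.card_erase_add_one hw
      have := Finset.card_erase_add_one hv
      omega
    · rwa [Finset.insert_erase hw, Finset.insert_erase hv]
  · rintro ⟨t, v, w⟩ H
    simp only [Finset.mem_sigma, Finset.mem_filter, Finset.mem_univ, true_and] at H ⊢
    obtain ⟨h1, h2, hv, hw, hf⟩ := H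
    refine ⟨⟨?_, hf⟩, by simp, by simp [h2.symm]⟩
    rw [Finset.card_insert_of_notMem (by simp [h2, hv]), Finset.card_insert_of_notMem hw, h1]
  · rintro ⟨u, v, w⟩ H
    simp only [Finset.mem_sigma] at H
    simp only [Finset.insert_erase H.2.2, Finset.insert_erase H.2.1]
  · rintro ⟨t, v, w⟩ H
    simp only [Finset.mem_sigma, Finset.mem_filter, Finset.mem_univ, true_and] at H
    obtain ⟨h1, h2, hv, hw, hf⟩ := H
    simp only [Sigma.mk.injEq, heq_eq_eq, and_true]
    rw [Finset.erase_insert (by simp [h2, hv]), Finset.erase_insert hw]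
  · rintro ⟨u, v, w⟩ H
    simp only [Finset.mem_sigma] at H
    simp only [Finset.insert_erase H.2.2, Finset.insert_erase H.2.1]

open Classical in
theorem sum_cofaces (r : ℕ) (g : Finset α → ℤ) :
    ∑ t with t.card + 1 = r, ∑ v with v ∉ t, g (insert v t) =
      r * ∑ s with s.card = r, g s := by
  have : ∀ s ∈ Finset.univ.filter (fun s : Finset α => s.card = r),
      (r : ℤ) * g s = ∑ v ∈ s, g s := by
    intro s hs
    simp only [Finset.mem_filter, Finset.mem_univ, true_and] at hs
    rw [Finset.sum_const, hs, nsmul_eq_mul]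
  rw [Finset.mul_sum, Finset.sum_congr rfl this, Finset.sum_sigma', Finset.sum_sigma']
  refine Finset.sum_bij' (fun p _ => ⟨insert p.2 p.1, p.2⟩) (fun p _ => ⟨p.1.erase p.2, p.2⟩)
    ?_ ?_ ?_ ?_ ?_
  · rintro ⟨s, v⟩ h
    simp only [Finset.mem_sigma, Finset.mem_filter, Finset.mem_univ, true_and] at h ⊢
    simp [Finset.card_insert_of_notMem h.2, h.1]
  · rintro ⟨u, v⟩ h
    simp only [Finset.mem_sigma, Finset.mem_filter, Finset.mem_univ, true_and] at h ⊢
    simp [Finset.card_erase_add_one h.2, h.1]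
  · rintro ⟨s, v⟩ h
    simp only [Finset.mem_sigma, Finset.mem_filter, Finset.mem_univ, true_and] at h
    simp [Finset.erase_insert h.2]
  · rintro ⟨u, v⟩ h
    simp only [Finset.mem_sigma] at h
    simp [Finset.insert_erase h.2]
  · rintro ⟨u, v⟩ h
    rfl

open Classical in
/-- Garland's inequality in integral form. -/
theorem garland_inequality (X : AbstractSimplicialComplex α) (r : ℕ) (a b c d : ℤ) (ha : 0 ≤ a)
    (hdeg : ∀ s, s.card = r → X.IsFace s →
      d ≤ (Finset.univ.filter fun v => v ∉ s ∧ X.IsFace (insert v s)).card)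
    (hgap : ∀ t, t.card + 1 = r → X.IsFace t → ∀ y : α → ℤ,
      (∀ v, ¬ (v ∉ t ∧ X.IsFace (insert v t)) → y v = 0) →
      a * ∑ v, ∑ w with (v ≠ w ∧ v ∉ t ∧ w ∉ t ∧ X.IsFace (insert v (insert w t))), y v * y w ≤
        b * ∑ v, y v ^ 2 + c * (∑ v, y v) ^ 2)
    (x : Finset α → ℤ) (hx : ∀ s, ¬ X.IsFace s → x s = 0) :
    (a * d - b * r) * ∑ s with s.card = r, x s ^ 2 ≤
      a * ∑ u with u.card = r + 1 ∧ X.IsFace u,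
        (∑ v ∈ u, vertexSign ℤ u v * x (u.erase v)) ^ 2 +
      c * ∑ t with t.card + 1 = r,
        (∑ v with v ∉ t, vertexSign ℤ (insert v t) v * x (insert v t)) ^ 2 := by
  -- `y t` is the localisation of `x` at the link of `t`. Its signs make the sum of its values the
  -- coefficient of `∂x` at `t`.
  let y : Finset α → α → ℤ := fun t v =>
    if v ∉ t then vertexSign ℤ (insert v t) v * x (insert v t) else 0
  have hexp : ∀ u : Finset α, (∑ v ∈ u, vertexSign ℤ u v * x (u.erase v)) ^ 2 =
      ∑ v ∈ u, x (u.erase v) ^ 2 + ∑ v ∈ u, ∑ w ∈ u.erase v,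
        vertexSign ℤ u v * x (u.erase v) * (vertexSign ℤ u w * x (u.erase w)) := by
    intro u
    rw [sq, Finset.sum_mul_sum, ← Finset.sum_add_distrib]
    refine Finset.sum_congr rfl fun v hv => ?_
    rw [← Finset.add_sum_erase _ _ hv]
    congr 1
    linear_combination (x (u.erase v)) ^ 2 * vertexSign_mul_self u v
  -- The minus sign comes from `vertexSign_mul_vertexSign`: the cross terms are minus the adjacency
  -- forms of the links, so upper bounds on these forms bound the coboundary from below.
  have hpairs : ∑ u with u.card = r + 1 ∧ X.IsFace u, ∑ v ∈ u, ∑ w ∈ u.erase v,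
        vertexSign ℤ u v * x (u.erase v) * (vertexSign ℤ u w * x (u.erase w)) =
      - ∑ t with t.card + 1 = r, ∑ v, ∑ w with (v ≠ w ∧ v ∉ t ∧ w ∉ t ∧
        X.IsFace (insert v (insert w t))), y t v * y t w := by
    rw [sum_faces_pairs, ← Finset.sum_neg_distrib]
    refine Finset.sum_congr rfl fun t _ => ?_
    rw [← Finset.sum_neg_distrib]
    refine Finset.sum_congr rfl fun v _ => ?_
    rw [← Finset.sum_neg_distrib]
    refine Finset.sum_congr rfl fun w hw => ?_
    simp only [Finset.mem_filter, Finset.mem_univ, true_and] at hw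
    obtain ⟨hvw, hv, hw, -⟩ := hw
    have h1 : (insert v (insert w t)).erase v = insert w t :=
      Finset.erase_insert (by simp [hvw, hv])
    have h2 : (insert v (insert w t)).erase w = insert v t := by
      rw [Finset.insert_comm, Finset.erase_insert (by simp [hvw.symm, hw])]
    simp only [y, hv, hw, not_false_eq_true, if_true, h1, h2]
    linear_combination x (insert w t) * x (insert v t) * vertexSign_mul_vertexSign hvw hv hw
  have hup : ∑ u with u.card = r + 1 ∧ X.IsFace u,
        (∑ v ∈ u, vertexSign ℤ u v * x (u.erase v)) ^ 2 =
      (∑ s with s.card = r, ∑ v with v ∉ s ∧ X.IsFace (insert v s), x s ^ 2) -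
      ∑ t with t.card + 1 = r, ∑ v, ∑ w with (v ≠ w ∧ v ∉ t ∧ w ∉ t ∧
        X.IsFace (insert v (insert w t))), y t v * y t w := by
    rw [Finset.sum_congr rfl fun u _ => hexp u, Finset.sum_add_distrib, hpairs,
      sum_faces_erase X r fun s => x s ^ 2, sub_eq_add_neg]
  have hdegsum : d * ∑ s with s.card = r, x s ^ 2 ≤
      ∑ s with s.card = r, ∑ v with v ∉ s ∧ X.IsFace (insert v s), x s ^ 2 := by
    rw [Finset.mul_sum]
    refine Finset.sum_le_sum fun s hs => ?_
    simp only [Finset.mem_filter, Finset.mem_univ, true_and] at hs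
    rw [Finset.sum_const, nsmul_eq_mul]
    by_cases hf : X.IsFace s
    · exact mul_le_mul_of_nonneg_right (hdeg s hs hf) (sq_nonneg _)
    · simp [hx s hf]
  have hsum : ∀ t, ∑ v, y t v = ∑ v with v ∉ t, vertexSign ℤ (insert v t) v * x (insert v t) := by
    intro t
    rw [Finset.sum_filter]
  -- Each set with `r` elements is seen from its `r` subsets with one element fewer; hence the
  -- factor `r` in `b * r`.
  have hsq : ∑ t with t.card + 1 = r, ∑ v, y t v ^ 2 = r * ∑ s with s.card = r, x s ^ 2 := by
    rw [← sum_cofaces]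
    refine Finset.sum_congr rfl fun t _ => ?_
    rw [Finset.sum_filter]
    refine Finset.sum_congr rfl fun v _ => ?_
    by_cases hv : v ∉ t
    · simp only [y, hv, not_false_eq_true, if_true]
      linear_combination x (insert v t) ^ 2 * vertexSign_mul_self (insert v t) v
    · simp [y, hv]
  have hlink : a * ∑ t with t.card + 1 = r, ∑ v, ∑ w with (v ≠ w ∧ v ∉ t ∧ w ∉ t ∧
        X.IsFace (insert v (insert w t))), y t v * y t w ≤
      ∑ t with t.card + 1 = r, (b * ∑ v, y t v ^ 2 + c * (∑ v, y t v) ^ 2) := by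
    rw [Finset.mul_sum]
    refine Finset.sum_le_sum fun t ht => ?_
    simp only [Finset.mem_filter, Finset.mem_univ, true_and] at ht
    by_cases hf : X.IsFace t
    · refine hgap t ht hf (y t) fun v hv => ?_
      by_cases hvt : v ∉ t
      · simp only [y, hvt, not_false_eq_true, if_true]
        rw [hx _ fun h => hv ⟨hvt, h⟩, mul_zero]
      · simp [y, hvt]
    · have : ∀ v, y t v = 0 := by
        intro v
        simp only [y]
        rw [hx _ fun h => hf (h.subset (Finset.subset_insert v t))]
        simp
      simp [this]
  rw [Finset.sum_add_distrib, ← Finset.mul_sum, ← Finset.mul_sum, hsq] at hlink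
  simp only [hsum] at hlink
  rw [hup]
  have := mul_le_mul_of_nonneg_left hdegsum ha
  linarith

/-- Garland's criterion: a minimal degree of the `r`-vertex faces which dominates the spectral
bound on the links of the `(r - 1)`-vertex faces kills the homology in degree `r - 1`. -/
theorem subsingleton_reducedHomology_of_garland (k : Type*) [Field k] [CharZero k]
    (X : AbstractSimplicialComplex α) (r : ℕ) (a b c d : ℤ) (ha : 0 ≤ a) (hab : b * r < a * d)
    (hdeg : ∀ s, s.card = r → X.IsFace s →
      d ≤ Nat.card {v // v ∉ s ∧ X.IsFace (insert v s)})
    (hgap : ∀ t, t.card + 1 = r → X.IsFace t → ∀ y : α → ℤ,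
      (∀ v, ¬ (v ∉ t ∧ X.IsFace (insert v t)) → y v = 0) →
      a * ∑ v, ∑ w, (open Classical in if v ≠ w ∧ v ∉ t ∧ w ∉ t ∧
        X.IsFace (insert v (insert w t)) then y v * y w else 0) ≤
        b * ∑ v, y v ^ 2 + c * (∑ v, y v) ^ 2) :
    Subsingleton (reducedHomology k X r) := by
  classical
  let S := {s : Finset α // s.card = r ∧ X.IsFace s}
  let U := {u : Finset α // u.card = r + 1 ∧ X.IsFace u}
  -- `e t s` is the coefficient of `t` in `∂s`. The rows of `A` run over all vertex sets, so that `A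
  -- z = 0` is `∂z = 0` read coefficientwise; rows of the wrong cardinality vanish (`hA0`).
  let e : Finset α → Finset α → ℤ := fun t s =>
    ∑ v ∈ s, if s.erase v = t then vertexSign ℤ s v else 0
  let A : Matrix (Finset α) S ℤ := Matrix.of fun t s => e t s.1
  let B : Matrix S U ℤ := Matrix.of fun s u => e s.1 u.1
  have hsign : ∀ (s : Finset α) (v : α), ((vertexSign ℤ s v : ℤ) : k) = vertexSign k s v := by
    intro s v; simp [vertexSign]
  have hbdZ : ∀ s t, boundary ℤ (Finsupp.single s 1) t = e t s := by
    intro s t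
    rw [boundary_single, one_smul, Finsupp.finsetSum_apply]
    simp only [Finsupp.single_apply, e]
  have hbdk : ∀ s t, boundary k (Finsupp.single s 1) t = (e t s : k) := by
    intro s t
    rw [boundary_single, one_smul, Finsupp.finsetSum_apply]
    simp only [Finsupp.single_apply, e]
    push_cast
    exact Finset.sum_congr rfl fun v _ => by rw [hsign]
  have hchain : ∀ (j : ℕ) (c : Finset α →₀ k), c ∈ chains k X j →
      c = ∑ s : {s : Finset α // s.card = j ∧ X.IsFace s}, c s.1 • Finsupp.single s.1 (1 : k) := by
    intro j c hc
    ext t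
    rw [Finsupp.finsetSum_apply]
    simp only [Finsupp.smul_single, smul_eq_mul, mul_one, Finsupp.single_apply]
    by_cases ht : t.card = j ∧ X.IsFace t
    · rw [Finset.sum_eq_single ⟨t, ht⟩]
      · simp
      · rintro s - hs
        exact if_neg fun h => hs (Subtype.ext h)
      · simp
    · rw [Finset.sum_eq_zero]
      · by_contra h
        exact ht (hc (Finsupp.mem_support_iff.2 h))
      · rintro s -
        exact if_neg fun h => ht (by rw [← h]; exact s.2)
  have hbd : ∀ (j : ℕ) (c : Finset α →₀ k), c ∈ chains k X j → ∀ t, boundary k c t =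
      ∑ s : {s : Finset α // s.card = j ∧ X.IsFace s}, (e t s.1 : k) * c s.1 := by
    intro j c hc t
    conv_lhs => rw [hchain j c hc, map_sum, Finsupp.finsetSum_apply]
    refine Finset.sum_congr rfl fun s _ => ?_
    rw [map_smul, Finsupp.smul_apply, hbdk, smul_eq_mul, mul_comm]
  have herase : ∀ (u : U) (v), v ∈ u.1 → (u.1.erase v).card = r ∧ X.IsFace (u.1.erase v) :=
    fun u v hv => ⟨by rw [Finset.card_erase_of_mem hv, u.2.1]; rfl,
      u.2.2.subset (Finset.erase_subset _ _)⟩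
  have hAB : A * B = 0 := by
    ext t u
    have h := DFunLike.congr_fun (boundary_boundary ℤ (Finsupp.single u.1 1)) t
    rw [boundary_single, one_smul, map_sum, Finsupp.finsetSum_apply] at h
    have h2 : ∀ v, boundary ℤ (Finsupp.single (u.1.erase v) (vertexSign ℤ u.1 v)) t =
        e t (u.1.erase v) * vertexSign ℤ u.1 v := by
      intro v
      rw [← hbdZ, ← mul_one (vertexSign ℤ u.1 v), ← smul_eq_mul, ← Finsupp.smul_single, map_smul,
        Finsupp.smul_apply, smul_eq_mul, smul_eq_mul, mul_one, mul_comm]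
    simp only [h2] at h
    rw [Matrix.zero_apply, Matrix.mul_apply, ← show _ = (0 : ℤ) from h]
    simp only [A, B, Matrix.of_apply]
    have h3 : ∀ s : S, e t s.1 * e s.1 u.1 =
        ∑ v ∈ u.1, if u.1.erase v = s.1 then e t s.1 * vertexSign ℤ u.1 v else 0 := by
      intro s
      simp only [e, Finset.mul_sum, mul_ite, mul_zero]
    rw [Finset.sum_congr rfl fun s _ => h3 s, Finset.sum_comm]
    refine Finset.sum_congr rfl fun v hv => ?_
    rw [Finset.sum_eq_single ⟨u.1.erase v, herase u v hv⟩]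
    · simp
    · rintro s - hs
      exact if_neg fun h => hs (Subtype.ext h.symm)
    · simp
  have hdef : ∀ x : S → ℤ, a * (B.transpose.mulVec x ⬝ᵥ B.transpose.mulVec x) +
      c * (A.mulVec x ⬝ᵥ A.mulVec x) = 0 → x = 0 := by
    intro x hx
    let x' : Finset α → ℤ := fun s => if h : s.card = r ∧ X.IsFace s then x ⟨s, h⟩ else 0
    have hx' : ∀ s : S, x' s.1 = x s := fun s => dif_pos s.2
    have hx0 : ∀ s, ¬ (s.card = r ∧ X.IsFace s) → x' s = 0 := fun s h => dif_neg h
    have hS : ∀ g : Finset α → ℤ, (∀ s, ¬ (s.card = r ∧ X.IsFace s) → g s = 0) →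
        ∑ s : S, g s.1 = ∑ s, g s := by
      intro g hg
      rw [← Finset.sum_subtype (p := fun s => s.card = r ∧ X.IsFace s)
        (Finset.univ.filter fun s => s.card = r ∧ X.IsFace s) (by simp) g,
        Finset.sum_filter_of_ne]
      intro s _ h
      by_contra h'
      exact h (hg s h')
    have hB : ∀ u : U, B.transpose.mulVec x u =
        ∑ v ∈ u.1, vertexSign ℤ u.1 v * x' (u.1.erase v) := by
      intro u
      simp only [Matrix.mulVec, dotProduct, Matrix.transpose_apply, B, Matrix.of_apply]
      rw [Finset.sum_congr rfl fun s _ => by rw [← hx' s],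
        hS (fun s => e s u.1 * x' s) fun s h => by rw [hx0 s h, mul_zero]]
      simp only [e, Finset.sum_mul, ite_mul, zero_mul]
      rw [Finset.sum_comm]
      exact Finset.sum_congr rfl fun v _ => by simp
    have hA : ∀ t, A.mulVec x t =
        ∑ v with v ∉ t, vertexSign ℤ (insert v t) v * x' (insert v t) := by
      intro t
      simp only [Matrix.mulVec, dotProduct, A, Matrix.of_apply]
      rw [Finset.sum_congr rfl fun s _ => by rw [← hx' s],
        hS (fun s => e t s * x' s) fun s h => by rw [hx0 s h, mul_zero]]
      simp only [e, Finset.sum_mul, ite_mul, zero_mul]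
      rw [Finset.sum_sigma', ← Finset.sum_filter]
      refine Finset.sum_bij' (fun p _ => p.2) (fun v _ => ⟨insert v t, v⟩) ?_ ?_ ?_ ?_ ?_
      · rintro ⟨s, v⟩ h
        simp only [Finset.mem_filter, Finset.mem_sigma] at h
        simp [← h.2]
      · intro v h
        simp only [Finset.mem_filter, Finset.mem_univ, true_and] at h
        simp [Finset.erase_insert h]
      · rintro ⟨s, v⟩ h
        simp only [Finset.mem_filter, Finset.mem_sigma] at h
        simp [← h.2, Finset.insert_erase h.1.2]
      · intro v _
        rfl
      · rintro ⟨s, v⟩ h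
        simp only [Finset.mem_filter, Finset.mem_sigma] at h
        simp [← h.2, Finset.insert_erase h.1.2]
    have hA0 : ∀ t, t.card + 1 ≠ r → A.mulVec x t = 0 := by
      intro t ht
      rw [hA]
      refine Finset.sum_eq_zero fun v hv => ?_
      simp only [Finset.mem_filter, Finset.mem_univ, true_and] at hv
      rw [hx0 _ fun h => ht (by rw [← h.1, Finset.card_insert_of_notMem hv]), mul_zero]
    have hg := garland_inequality X r a b c d ha
      (fun s hs hf => (hdeg s hs hf).trans
        (by rw [Nat.card_eq_fintype_card, Fintype.card_subtype]))
      (fun t ht hf y hy => by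
        simp only [Finset.sum_filter]
        convert hgap t ht hf y hy) x' (fun s hs => hx0 s fun h => hs h.2)
    have e1 : B.transpose.mulVec x ⬝ᵥ B.transpose.mulVec x =
        ∑ u with u.card = r + 1 ∧ X.IsFace u,
          (∑ v ∈ u, vertexSign ℤ u v * x' (u.erase v)) ^ 2 := by
      rw [Finset.sum_subtype (p := fun s => s.card = r + 1 ∧ X.IsFace s) _ (by simp)]
      simp only [dotProduct, hB, ← sq]
      rfl
    have e2 : A.mulVec x ⬝ᵥ A.mulVec x = ∑ t with t.card + 1 = r,
        (∑ v with v ∉ t, vertexSign ℤ (insert v t) v * x' (insert v t)) ^ 2 := by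
      simp only [dotProduct, ← hA, ← sq]
      rw [Finset.sum_filter_of_ne]
      intro t _ h
      by_contra h'
      exact h (by rw [hA0 t h']; rfl)
    rw [← e1, ← e2, hx] at hg
    have hpos : ∑ s with s.card = r, x' s ^ 2 = 0 := by
      refine le_antisymm ?_ (Finset.sum_nonneg fun s _ => sq_nonneg _)
      by_contra h
      push Not at h
      have := mul_pos (sub_pos.2 hab) h
      linarith
    rw [Finset.sum_eq_zero_iff_of_nonneg fun s _ => sq_nonneg _] at hpos
    ext s
    have := hpos s.1 (by simp [s.2.1])
    rw [hx'] at this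
    simpa using this
  have hle : cycles k X r ≤ boundaries k X r := by
    rintro z ⟨hz, hz0⟩
    have hz0 : boundary k z = 0 := hz0
    obtain ⟨w, hw⟩ := Matrix.exists_mulVec_eq_of_laplacian_definite A B hAB a c hdef
      (fun s : S => z s.1) (by
        ext t
        have := hbd r z hz t
        rw [hz0] at this
        simpa [Matrix.mulVec, dotProduct, A] using this.symm)
    let w' : Finset α →₀ k := ∑ u : U, w u • Finsupp.single u.1 1
    have hw' : w' ∈ chains k X (r + 1) :=
      Submodule.sum_mem _ fun u _ => Submodule.smul_mem _ _
        (Finsupp.single_mem_supported k _ u.2)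
    have hww : ∀ u : U, w' u.1 = w u := by
      intro u
      simp only [w', Finsupp.finsetSum_apply, Finsupp.smul_single, smul_eq_mul, mul_one,
        Finsupp.single_apply]
      rw [Finset.sum_eq_single u]
      · simp
      · rintro s - hs
        exact if_neg fun h => hs (Subtype.ext h)
      · simp
    refine ⟨w', hw', ?_⟩
    have hbc := boundary_mem_chains k X r hw'
    ext t
    by_cases ht : t.card = r ∧ X.IsFace t
    · rw [hbd (r + 1) w' hw' t, ← congrFun hw ⟨t, ht⟩]
      simp only [Matrix.mulVec, dotProduct, B, Matrix.map_apply, Matrix.of_apply]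
      exact Finset.sum_congr rfl fun u _ => by rw [hww u]
    · have hout : ∀ c : Finset α →₀ k, c ∈ chains k X r → c t = 0 := by
        intro c hc
        by_contra h
        exact ht (hc (Finsupp.mem_support_iff.2 h))
      rw [hout _ hbc, hout _ hz]
  exact Submodule.Quotient.subsingleton_iff.2 (Submodule.submoduleOf_eq_top.2 hle)

end Garland

end AbstractSimplicialComplex

/-! ### The norm of a quadratic extension of finite fields -/

section NormFibre

variable {K : Type*} [Field K] {τ : K →+* K}

/-- For any `z` moved by `τ`, the pair `1, z` is a basis of `K` over the fixed field; the
`z`-coordinate of `x` is `(x - τ x) / (z - τ z)`. -/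
theorem card_fixedPoints_sq_of_involutive (hinv : ∀ x, τ (τ x) = x) (hne : τ ≠ RingHom.id K) :
    Nat.card {x : K // τ x = x} ^ 2 = Nat.card K := by
  obtain ⟨z, hz⟩ : ∃ z, τ z ≠ z := by
    by_contra! h
    exact hne (RingHom.ext h)
  have hz' : z - τ z ≠ 0 := sub_ne_zero.2 hz.symm
  rw [sq, ← Nat.card_prod]
  refine Nat.card_eq_of_bijective
    (fun p : {x : K // τ x = x} × {x : K // τ x = x} => p.1.1 + p.2.1 * z) ⟨?_, ?_⟩
  · rintro ⟨⟨f, hf⟩, ⟨g, hg⟩⟩ ⟨⟨f', hf'⟩, ⟨g', hg'⟩⟩ h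
    simp only at h
    have h2 := congrArg τ h
    simp only [map_add, map_mul, hf, hg, hf', hg'] at h2
    have h3 : (g - g') * (z - τ z) = 0 := by linear_combination h - h2
    have h4 : g = g' := sub_eq_zero.1 ((mul_eq_zero.1 h3).resolve_right hz')
    subst h4
    simpa using h
  · intro x
    have hτz : τ z - z ≠ 0 := sub_ne_zero.2 hz
    have hg : τ ((x - τ x) / (z - τ z)) = (x - τ x) / (z - τ z) := by
      rw [map_div₀, map_sub, map_sub, hinv, hinv, ← neg_sub x, ← neg_sub z, neg_div_neg_eq]
    refine ⟨⟨⟨x - (x - τ x) / (z - τ z) * z, ?_⟩, ⟨_, hg⟩⟩, by simp⟩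
    rw [map_sub, map_mul, hg]
    linear_combination div_mul_cancel₀ (x - τ x) hz'

/-- The norm `x ↦ x * τ x` of a finite field onto the fixed field of an involution has fibres of
size `q + 1` over the nonzero fixed elements. -/
theorem card_norm_fibre [Finite K] (hinv : ∀ x, τ (τ x) = x) (hne : τ ≠ RingHom.id K) {q : ℕ}
    (hq : Nat.card K = q ^ 2) {a : K} (ha : a ≠ 0) (hτa : τ a = a) :
    Nat.card {x : K // x * τ x = a} = q + 1 := by
  have hF : Nat.card {x : K // τ x = x} = q := by
    have := card_fixedPoints_sq_of_involutive hinv hne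
    rw [hq] at this
    exact Nat.pow_left_injective two_ne_zero this
  let σ : Kˣ →* Kˣ := Units.map τ
  let φ : Kˣ →* Kˣ := MonoidHom.id Kˣ / σ
  let ν : Kˣ →* Kˣ := MonoidHom.id Kˣ * σ
  have hσσ : ∀ u, σ (σ u) = u := fun u => Units.ext (hinv u)
  have hφ : ∀ u, φ u = u / σ u := fun u => rfl
  have hν : ∀ u, ν u = u * σ u := fun u => rfl
  have hφker : ∀ u : Kˣ, u ∈ φ.ker ↔ τ u = u := by
    intro u
    rw [MonoidHom.mem_ker, hφ, div_eq_one, Units.ext_iff]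
    exact eq_comm
  -- Hilbert 90: if `u * τ u = 1`, then `w = z + u * τ z` satisfies `w = u * τ w`. A `z` with `w ≠
  -- 0` exists, since otherwise `z = 1` gives `u = -1` and then `τ` is the identity.
  have hrange : φ.range = ν.ker := by
    ext u
    constructor
    · rintro ⟨v, rfl⟩
      rw [MonoidHom.mem_ker, hν, hφ, map_div, hσσ, div_mul_div_cancel, div_self']
    · intro hu
      rw [MonoidHom.mem_ker, hν] at hu
      have hu' : (u : K) * τ u = 1 := by simpa [σ] using congrArg Units.val hu
      obtain ⟨z, hz⟩ : ∃ z, z + u * τ z ≠ 0 := by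
        by_contra! h
        have h1 := h 1
        rw [map_one, mul_one] at h1
        refine hne (RingHom.ext fun x => ?_)
        have h2 : (u : K) = -1 := by linear_combination h1
        have h3 := h x
        rw [h2] at h3
        rw [RingHom.id_apply]
        linear_combination -h3
      refine ⟨Units.mk0 _ hz, ?_⟩
      rw [hφ, div_eq_iff_eq_mul]
      ext
      simp only [Units.val_mk0, Units.val_mul, σ, Units.coe_map, MonoidHom.coe_coe, map_add,
        map_mul, hinv]
      linear_combination -z * hu'
  have hνrange : ν.range ≤ φ.ker := by
    rintro _ ⟨u, rfl⟩
    rw [MonoidHom.mem_ker, hφ, hν, map_mul, hσσ, mul_comm, div_self']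
  -- Comparing the two factorisations of the order of `Kˣ` shows that the norm `ν` is onto the units
  -- of the fixed field, which number `q - 1`; so its kernel has `(q ^ 2 - 1) / (q - 1)` elements.
  have h1 : Nat.card φ.ker * Nat.card ν.ker = Nat.card Kˣ := by
    rw [← hrange, ← Subgroup.index_ker, Subgroup.card_mul_index]
  have h2 : Nat.card ν.ker * Nat.card ν.range = Nat.card Kˣ := by
    rw [← Subgroup.index_ker, Subgroup.card_mul_index]
  have hpos : 0 < Nat.card ν.ker := Nat.card_pos
  have h3 : Nat.card ν.range = Nat.card φ.ker := by
    rw [mul_comm] at h1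
    exact Nat.eq_of_mul_eq_mul_left hpos (h2.trans h1.symm)
  have h4 : ν.range = φ.ker := Subgroup.eq_of_le_of_card_ge hνrange h3.ge
  have h5 : Nat.card φ.ker + 1 = q := by
    rw [← hF, ← Finite.card_option]
    refine Nat.card_eq_of_bijective (fun o : Option φ.ker =>
      o.elim (⟨0, map_zero τ⟩ : {x : K // τ x = x}) fun u => ⟨u.1, (hφker _).1 u.2⟩) ⟨?_, ?_⟩
    · rintro (_ | u) (_ | v) h
      · rfl
      · exact absurd (congrArg Subtype.val h).symm v.1.ne_zero
      · exact absurd (congrArg Subtype.val h) u.1.ne_zero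
      · exact congrArg some (Subtype.ext (Units.ext (congrArg Subtype.val h)))
    · rintro ⟨x, hx⟩
      by_cases h : x = 0
      · exact ⟨none, Subtype.ext h.symm⟩
      · exact ⟨some ⟨Units.mk0 x h, (hφker _).2 hx⟩, rfl⟩
  have h6 : Nat.card ν.ker = q + 1 := by
    rw [Nat.card_units, hq] at h1
    obtain ⟨p, rfl⟩ : ∃ p, q = p + 1 := ⟨_, h5.symm⟩
    have hp : Nat.card φ.ker = p := by omega
    have hp0 : 0 < p := hp ▸ Nat.card_pos
    rw [hp] at h1
    refine Nat.eq_of_mul_eq_mul_left hp0 (h1.trans ?_)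
    have : (p + 1) ^ 2 = p * (p + 1 + 1) + 1 := by ring
    omega
  obtain ⟨b, hb⟩ : Units.mk0 a ha ∈ ν.range := by
    rw [h4, hφker]
    exact hτa
  have hb' : (b : K) * τ b = a := by
    have := congrArg Units.val hb
    simpa [hν, σ] using this
  rw [← h6]
  have hker : ∀ u : Kˣ, u ∈ ν.ker ↔ (u : K) * τ u = 1 := by
    intro u
    rw [MonoidHom.mem_ker, hν, Units.ext_iff]
    rfl
  refine (Nat.card_eq_of_bijective (fun u : ν.ker => (⟨b * u.1, ?_⟩ : {x : K // x * τ x = a}))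
    ⟨?_, ?_⟩).symm
  · have := (hker u.1).1 u.2
    rw [map_mul]
    linear_combination b * τ b * this + hb'
  · intro u v h
    have := congrArg Subtype.val h
    exact Subtype.ext (Units.ext (mul_left_cancel₀ b.ne_zero this))
  · rintro ⟨x, hx⟩
    have hx0 : x ≠ 0 := by
      rintro rfl
      exact ha (by rw [← hx, zero_mul])
    refine ⟨⟨b⁻¹ * Units.mk0 x hx0, ?_⟩, Subtype.ext ?_⟩
    · have hν' : ν (Units.mk0 x hx0) = Units.mk0 a ha := by
        ext
        simpa [hν, σ] using hx
      rw [MonoidHom.mem_ker, map_mul, map_inv, hb, hν', inv_mul_cancel]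
    · simp

end NormFibre

/-! ### Orthogonal complements and isotropic vectors -/

namespace UnitaryForm

variable {K : Type*} [Field K] {τ : K →+* K} {V : Type*} [AddCommGroup V] [Module K V]
  (Ψ : UnitaryForm τ V)

theorem form_eq_zero_comm {v w : V} : Ψ.form v w = 0 ↔ Ψ.form w v = 0 := by
  constructor <;> intro h <;> rw [Ψ.hermitian, h, map_zero]

theorem form_add_smul_self {w e : V} (h : Ψ.form w e = 0) (c : K) :
    Ψ.form (w + c • e) (w + c • e) = Ψ.form w w + c * τ c * Ψ.form e e := by
  simp only [map_add, LinearMap.add_apply, map_smul, LinearMap.smul_apply, map_smulₛₗ,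
    smul_eq_mul, h, Ψ.form_eq_zero_comm.1 h]
  ring

/-- The vectors orthogonal to `e`. -/
def orthogonalTo (e : V) : Submodule K V where
  carrier := {w | Ψ.form w e = 0}
  add_mem' := by
    intro v w hv hw
    simp only [Set.mem_ofPred_eq] at hv hw ⊢
    rw [map_add, LinearMap.add_apply, hv, hw, add_zero]
  zero_mem' := by simp
  smul_mem' := by
    intro c w hw
    simp only [Set.mem_ofPred_eq] at hw ⊢
    rw [map_smul, LinearMap.smul_apply, hw, smul_zero]

theorem mem_orthogonalTo {e w : V} : w ∈ Ψ.orthogonalTo e ↔ Ψ.form w e = 0 := Iff.rfl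

/-- The intersection is the kernel of a nonzero functional on `W`. The vector `e` may lie outside
`W`, as is needed when a second line is cut out. -/
theorem finrank_inf_orthogonalTo [FiniteDimensional K V] (W : Submodule K V) {e w : V}
    (hw : w ∈ W) (hwe : Ψ.form w e ≠ 0) :
    Module.finrank K (W ⊓ Ψ.orthogonalTo e : Submodule K V) + 1 = Module.finrank K W := by
  let f : W →ₗ[K] K :=
    { toFun := fun v => Ψ.form v.1 e
      map_add' := by intro v w; simp
      map_smul' := by intro c v; simp }
  have hf : f ≠ 0 := fun h => hwe (DFunLike.congr_fun h ⟨w, hw⟩)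
  have hr : Module.finrank K (LinearMap.range f) = 1 := by
    rw [LinearMap.range_eq_top.2 (LinearMap.surjective hf), finrank_top, Module.finrank_self]
  have hk : Module.finrank K (LinearMap.ker f) =
      Module.finrank K (W ⊓ Ψ.orthogonalTo e : Submodule K V) := by
    rw [← Submodule.map_comap_subtype, Submodule.finrank_map_subtype_eq]
    rfl
  have := LinearMap.finrank_range_add_finrank_ker f
  omega

variable {Ψ}

theorem IsNondegenerateSubspace.top : Ψ.IsNondegenerateSubspace ⊤ := by
  intro v _ h
  exact Ψ.nondegenerate.1 v fun w => h w trivial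

theorem IsNondegenerateSubspace.inf_orthogonalTo {W : Submodule K V}
    (hW : Ψ.IsNondegenerateSubspace W) {e : V} (heW : e ∈ W) (he : Ψ.form e e ≠ 0) :
    Ψ.IsNondegenerateSubspace (W ⊓ Ψ.orthogonalTo e) := by
  rintro v ⟨hvW, hve⟩ h
  have hve : Ψ.form v e = 0 := hve
  refine hW v hvW fun w hw => ?_
  have h1 : Ψ.form (w - (Ψ.form w e / Ψ.form e e) • e) e = 0 := by
    rw [map_sub, LinearMap.sub_apply, map_smul, LinearMap.smul_apply, smul_eq_mul,
      div_mul_cancel₀ _ he, sub_self]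
  have h2 := h _ ⟨W.sub_mem hw (W.smul_mem _ heW), h1⟩
  rwa [map_sub, map_smulₛₗ, hve, smul_zero, sub_zero] at h2

/-- If all vectors of `W` were isotropic, polarisation would give `x + τ x = 0` for every `x`.
Taking `x = 1` yields characteristic `2`, and then `τ` is the identity. The argument is uniform in
the characteristic. -/
theorem IsNondegenerateSubspace.exists_form_self_ne_zero {W : Submodule K V}
    (hW : Ψ.IsNondegenerateSubspace W) (hW0 : W ≠ ⊥) : ∃ e ∈ W, Ψ.form e e ≠ 0 := by
  by_contra! H
  obtain ⟨v, hv, hv0⟩ := W.exists_mem_ne_zero_of_ne_bot hW0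
  obtain ⟨w, hw, hvw⟩ : ∃ w ∈ W, Ψ.form v w ≠ 0 := by
    by_contra! h
    exact hv0 (hW v hv h)
  have key : ∀ x : K, x + τ x = 0 := by
    intro x
    have h := H ((x / Ψ.form v w) • v + w) (W.add_mem (W.smul_mem _ hv) hw)
    simp only [map_add, LinearMap.add_apply, map_smul, LinearMap.smul_apply, map_smulₛₗ,
      smul_eq_mul, H v hv, H w hw] at h
    rw [Ψ.hermitian w v, div_mul_cancel₀ _ hvw, mul_zero, zero_add, ← map_mul,
      div_mul_cancel₀ _ hvw] at h
    linear_combination h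
  refine Ψ.ne_id (RingHom.ext fun x => ?_)
  have h1 := key 1
  have hx := key x
  rw [map_one] at h1
  rw [RingHom.id_apply]
  linear_combination hx - x * h1

/-- In `W = W' ⊕ K e`, the vector `w + x e` is isotropic exactly when the norm of `x` is `-(w, w) /
(e, e)`. This has one solution if `w` is isotropic and `q + 1` otherwise. -/
theorem card_isotropic_recursion [Finite K] [FiniteDimensional K V]
    {q : ℕ} (hq : Nat.card K = q ^ 2) (W : Submodule K V) {e : V}
    (heW : e ∈ W) (he : Ψ.form e e ≠ 0) :
    (Nat.card {v : W // Ψ.form v.1 v.1 = 0} : ℤ) =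
      (q + 1) * Nat.card (W ⊓ Ψ.orthogonalTo e : Submodule K V) -
      q * Nat.card {v : (W ⊓ Ψ.orthogonalTo e : Submodule K V) // Ψ.form v.1 v.1 = 0} := by
  classical
  have : Finite V := Module.finite_of_finite K
  set W' := W ⊓ Ψ.orthogonalTo e
  have := Fintype.ofFinite W'
  have hτ : ∀ v, τ (Ψ.form v v) = Ψ.form v v := fun v => (Ψ.hermitian v v).symm
  have hbij : Nat.card {v : W // Ψ.form v.1 v.1 = 0} =
      Nat.card (Σ w : W', {x : K // Ψ.form w.1 w.1 + x * τ x * Ψ.form e e = 0}) := by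
    refine (Nat.card_eq_of_bijective (fun p : (Σ w : W',
      {x : K // Ψ.form w.1 w.1 + x * τ x * Ψ.form e e = 0}) =>
      (⟨⟨p.1.1 + p.2.1 • e, W.add_mem p.1.2.1 (W.smul_mem _ heW)⟩,
        (Ψ.form_add_smul_self p.1.2.2 _).trans p.2.2⟩ : {v : W // Ψ.form v.1 v.1 = 0}))
      ⟨?_, ?_⟩).symm
    · rintro ⟨⟨w, hw⟩, ⟨x, hx⟩⟩ ⟨⟨w', hw'⟩, ⟨x', hx'⟩⟩ h
      have h1 : w + x • e = w' + x' • e := by simpa using h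
      have h2 := congrArg (fun v => Ψ.form v e) h1
      simp only [map_add, LinearMap.add_apply, map_smul, LinearMap.smul_apply, smul_eq_mul,
        Ψ.mem_orthogonalTo.1 hw.2, Ψ.mem_orthogonalTo.1 hw'.2, zero_add] at h2
      have h3 : x = x' := mul_right_cancel₀ he h2
      subst h3
      have h4 : w = w' := by simpa using h1
      subst h4
      rfl
    · rintro ⟨⟨v, hv⟩, h⟩
      have h1 : v - (Ψ.form v e / Ψ.form e e) • e ∈ W' := by
        refine ⟨W.sub_mem hv (W.smul_mem _ heW), ?_⟩
        change Ψ.form _ e = 0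
        rw [map_sub, LinearMap.sub_apply, map_smul, LinearMap.smul_apply, smul_eq_mul,
          div_mul_cancel₀ _ he, sub_self]
      refine ⟨⟨⟨_, h1⟩, ⟨Ψ.form v e / Ψ.form e e, ?_⟩⟩, ?_⟩
      · rw [← Ψ.form_add_smul_self h1.2]
        simpa using h
      · simp
  have hfib : ∀ w : W', (Nat.card {x : K // Ψ.form w.1 w.1 + x * τ x * Ψ.form e e = 0} : ℤ) =
      (q + 1) - q * (if Ψ.form w.1 w.1 = 0 then 1 else 0) := by
    intro w
    by_cases hw : Ψ.form w.1 w.1 = 0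
    · rw [if_pos hw]
      have : Nat.card {x : K // Ψ.form w.1 w.1 + x * τ x * Ψ.form e e = 0} = 1 := by
        rw [Nat.card_eq_one_iff_unique]
        refine ⟨⟨?_⟩, ⟨⟨0, by simp [hw]⟩⟩⟩
        have : ∀ x : K, Ψ.form w.1 w.1 + x * τ x * Ψ.form e e = 0 → x = 0 := by
          intro x hx
          simpa [hw, he] using hx
        rintro ⟨x, hx⟩ ⟨y, hy⟩
        exact Subtype.ext ((this x hx).trans (this y hy).symm)
      rw [this]; push_cast; ring
    · rw [if_neg hw]
      have h := card_norm_fibre Ψ.involutive Ψ.ne_id hq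
        (a := -Ψ.form w.1 w.1 / Ψ.form e e) (div_ne_zero (neg_ne_zero.2 hw) he)
        (by rw [map_div₀, map_neg, hτ, hτ])
      have h' : ∀ x : K, Ψ.form w.1 w.1 + x * τ x * Ψ.form e e = 0 ↔
          x * τ x = -Ψ.form w.1 w.1 / Ψ.form e e := by
        intro x
        rw [eq_div_iff he, eq_neg_iff_add_eq_zero, add_comm]
      simp only [h', h]
      push_cast; ring
  have hiso : Nat.card {v : W' // Ψ.form v.1 v.1 = 0} =
      (Finset.univ.filter fun v : W' => Ψ.form v.1 v.1 = 0).card := by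
    rw [Nat.card_eq_fintype_card, Fintype.card_subtype]
  rw [hbij, Nat.card_sigma, Nat.cast_sum, Finset.sum_congr rfl fun w _ => hfib w,
    Finset.sum_sub_distrib, ← Finset.mul_sum, Finset.sum_boole, Finset.sum_const,
    hiso, Nat.card_eq_fintype_card (α := W'), nsmul_eq_mul, Finset.card_univ]
  ring

/-- The number of isotropic vectors of a nondegenerate subspace. -/
theorem IsNondegenerateSubspace.card_isotropic [Finite K] [FiniteDimensional K V]
    {q : ℕ} (hq : Nat.card K = q ^ 2) {l : ℕ} {W : Submodule K V}
    (hW : Ψ.IsNondegenerateSubspace W) (hl : Module.finrank K W = l) :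
    (q : ℤ) * Nat.card {v : W // Ψ.form v.1 v.1 = 0} =
      q ^ (2 * l) + (-1) ^ l * (q - 1) * q ^ l := by
  have : Finite V := Module.finite_of_finite K
  induction l generalizing W with
  | zero =>
    rw [Submodule.finrank_eq_zero] at hl
    subst hl
    have : Nat.card {v : (⊥ : Submodule K V) // Ψ.form v.1 v.1 = 0} = 1 := by
      rw [Nat.card_eq_one_iff_unique]
      exact ⟨inferInstance, ⟨⟨0, by simp⟩⟩⟩
    rw [this]; push_cast; ring
  | succ l ih =>
    have hW0 : W ≠ ⊥ := by
      rintro rfl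
      simp at hl
    obtain ⟨e, heW, he⟩ := hW.exists_form_self_ne_zero hW0
    have hl' : Module.finrank K (W ⊓ Ψ.orthogonalTo e : Submodule K V) = l := by
      have := Ψ.finrank_inf_orthogonalTo W heW he
      omega
    have h1 := ih (hW.inf_orthogonalTo heW he) hl'
    rw [card_isotropic_recursion hq W heW he, Module.natCard_eq_pow_finrank (K := K), hl', hq]
    push_cast
    linear_combination (-q : ℤ) * h1

end UnitaryForm

/-! ### Nondegenerate lines and the links of the frame complex -/

namespace UnitaryForm

variable {K : Type*} [Field K] {τ : K →+* K} {V : Type*} [AddCommGroup V] [Module K V]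
  {Ψ : UnitaryForm τ V}

namespace NondegenerateLine

theorem exists_generator (p : Ψ.NondegenerateLine) : ∃ e : V, p.1 = K ∙ e ∧ Ψ.form e e ≠ 0 := by
  obtain ⟨⟨e, he⟩, he0, h⟩ := finrank_eq_one_iff'.1 p.2.1
  have hp : p.1 = K ∙ e := by
    refine le_antisymm (fun w hw => ?_) ((Submodule.span_singleton_le_iff_mem _ _).2 he)
    obtain ⟨c, hc⟩ := h ⟨w, hw⟩
    exact Submodule.mem_span_singleton.2 ⟨c, congrArg Subtype.val hc⟩
  refine ⟨e, hp, fun h0 => he0 (Subtype.ext (p.2.2 e he fun w hw => ?_))⟩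
  rw [hp] at hw
  obtain ⟨c, rfl⟩ := Submodule.mem_span_singleton.1 hw
  rw [map_smulₛₗ, h0, smul_zero]

/-- A chosen generator of a nondegenerate line. -/
noncomputable def generator (p : Ψ.NondegenerateLine) : V := p.exists_generator.choose

theorem eq_span_generator (p : Ψ.NondegenerateLine) : p.1 = K ∙ p.generator :=
  p.exists_generator.choose_spec.1

theorem form_generator_self (p : Ψ.NondegenerateLine) : Ψ.form p.generator p.generator ≠ 0 :=
  p.exists_generator.choose_spec.2

theorem eq_of_generator_eq_smul {p p' : Ψ.NondegenerateLine} {c : K}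
    (h : p.generator = c • p'.generator) : p = p' := by
  have hc : c ≠ 0 := by
    rintro rfl
    refine p.form_generator_self ?_
    rw [h, zero_smul, map_zero]
  apply Subtype.ext
  rw [p.eq_span_generator, p'.eq_span_generator, h,
    Submodule.span_singleton_smul_eq (IsUnit.mk0 c hc)]

theorem exists_smul_generator_eq {v : V} (hv : Ψ.form v v ≠ 0) :
    ∃ (p : Ψ.NondegenerateLine) (c : Kˣ), c • p.generator = v := by
  have hv0 : v ≠ 0 := by
    rintro rfl
    exact hv (by simp)
  let p : Ψ.NondegenerateLine := ⟨K ∙ v, finrank_span_singleton hv0, by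
    intro w hw h
    obtain ⟨c, rfl⟩ := Submodule.mem_span_singleton.1 hw
    have h1 := h v (Submodule.mem_span_singleton_self v)
    rw [map_smul, LinearMap.smul_apply, smul_eq_mul] at h1
    rw [(mul_eq_zero.1 h1).resolve_right hv, zero_smul]⟩
  have hvp : v ∈ K ∙ p.generator := by
    rw [← p.eq_span_generator]
    exact Submodule.mem_span_singleton_self v
  obtain ⟨c, hc⟩ := Submodule.mem_span_singleton.1 hvp
  have hc0 : c ≠ 0 := by
    rintro rfl
    exact hv0 (by rw [← hc, zero_smul])
  exact ⟨p, Units.mk0 c hc0, hc⟩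

end NondegenerateLine

theorem orthogonalityGraph_adj {p p' : Ψ.NondegenerateLine} :
    Ψ.orthogonalityGraph.Adj p p' ↔ Ψ.form p.generator p'.generator = 0 := by
  constructor
  · intro h
    refine h.2 _ ?_ _ ?_
    · rw [p.eq_span_generator]
      exact Submodule.mem_span_singleton_self _
    · rw [p'.eq_span_generator]
      exact Submodule.mem_span_singleton_self _
  · intro h
    refine ⟨?_, fun v hv w hw => ?_⟩
    · rintro rfl
      exact p.form_generator_self h
    · rw [p.eq_span_generator] at hv
      rw [p'.eq_span_generator] at hw
      obtain ⟨c, rfl⟩ := Submodule.mem_span_singleton.1 hv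
      obtain ⟨d, rfl⟩ := Submodule.mem_span_singleton.1 hw
      simp [h]

variable (Ψ) in
/-- The orthogonal complement of a set of nondegenerate lines. -/
noncomputable def perp (t : Finset Ψ.NondegenerateLine) : Submodule K V :=
  ⨅ p ∈ t, Ψ.orthogonalTo p.generator

theorem mem_perp {t : Finset Ψ.NondegenerateLine} {w : V} :
    w ∈ Ψ.perp t ↔ ∀ p ∈ t, Ψ.form w p.generator = 0 := by
  simp [perp, Submodule.mem_iInf, Ψ.mem_orthogonalTo]

theorem frameComplex_isFace_iff {t : Finset Ψ.NondegenerateLine} :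
    Ψ.frameComplex.IsFace t ↔ Ψ.orthogonalityGraph.IsClique (t : Set Ψ.NondegenerateLine) := by
  constructor
  · rintro (rfl | h)
    · simp
    · exact h.2
  · intro h
    rcases t.eq_empty_or_nonempty with ht | ht
    · exact Or.inl ht
    · exact Or.inr ⟨ht, h⟩

section

variable [DecidableEq Ψ.NondegenerateLine]

theorem perp_insert (t : Finset Ψ.NondegenerateLine) (p : Ψ.NondegenerateLine) :
    Ψ.perp (insert p t) = Ψ.perp t ⊓ Ψ.orthogonalTo p.generator := by
  rw [perp, perp, Finset.iInf_insert, inf_comm]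

/-- The vertices of the link of `t` are the lines in `t^⊥`. That `p ∉ t` is automatic, because a
nondegenerate line is not orthogonal to itself. -/
theorem isFace_insert_iff {t : Finset Ψ.NondegenerateLine} (ht : Ψ.frameComplex.IsFace t)
    {p : Ψ.NondegenerateLine} :
    p ∉ t ∧ Ψ.frameComplex.IsFace (insert p t) ↔ p.generator ∈ Ψ.perp t := by
  rw [frameComplex_isFace_iff] at ht ⊢
  rw [mem_perp, Finset.coe_insert, SimpleGraph.isClique_insert]
  constructor
  · rintro ⟨hp, -, h⟩ p' hp'
    exact orthogonalityGraph_adj.1 (h p' hp' fun e => hp (e ▸ hp'))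
  · intro h
    exact ⟨fun hp => p.form_generator_self (h p hp), ht,
      fun p' hp' _ => orthogonalityGraph_adj.2 (h p' hp')⟩

theorem isFace_insert_insert_iff {t : Finset Ψ.NondegenerateLine}
    (ht : Ψ.frameComplex.IsFace t) {p p' : Ψ.NondegenerateLine} :
    (p ≠ p' ∧ p ∉ t ∧ p' ∉ t ∧ Ψ.frameComplex.IsFace (insert p (insert p' t))) ↔
      p.generator ∈ Ψ.perp t ∧ p'.generator ∈ Ψ.perp t ∧
        Ψ.form p.generator p'.generator = 0 := by
  constructor
  · rintro ⟨hne, hp, hp', h⟩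
    have h' := h.subset (Finset.subset_insert p (insert p' t))
    have h1 := (isFace_insert_iff h').1 ⟨by simp [hne, hp], h⟩
    rw [perp_insert] at h1
    exact ⟨h1.1, (isFace_insert_iff ht).1 ⟨hp', h'⟩, h1.2⟩
  · rintro ⟨hp, hp', h⟩
    have h' := (isFace_insert_iff ht).2 hp'
    have h2 := (isFace_insert_iff (p := p) h'.2).2 (by rw [perp_insert]; exact ⟨hp, h⟩)
    exact ⟨fun e => h2.1 (by simp [e]), ((isFace_insert_iff ht).2 hp).1, h'.1, h2.2⟩

theorem isNondegenerateSubspace_perp_and_finrank [FiniteDimensional K V]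
    {t : Finset Ψ.NondegenerateLine} (ht : Ψ.frameComplex.IsFace t) :
    Ψ.IsNondegenerateSubspace (Ψ.perp t) ∧
      Module.finrank K (Ψ.perp t) + t.card = Module.finrank K V := by
  induction t using Finset.induction_on with
  | empty =>
    have : Ψ.perp ∅ = ⊤ := by simp [perp]
    rw [this]
    exact ⟨IsNondegenerateSubspace.top, by simp⟩
  | insert p t hp ih =>
    have ht' := ht.subset (Finset.subset_insert p t)
    have hpt := (isFace_insert_iff ht').1 ⟨hp, ht⟩
    obtain ⟨h1, h2⟩ := ih ht'
    rw [perp_insert, Finset.card_insert_of_notMem hp]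
    refine ⟨h1.inf_orthogonalTo hpt p.form_generator_self, ?_⟩
    have := Ψ.finrank_inf_orthogonalTo _ hpt p.form_generator_self
    omega

end

/-- The component `e` of the second generator orthogonal to the first is nonzero but possibly
isotropic. Nondegeneracy of `W ⊓ p^⊥` still supplies a vector of it that is not orthogonal to `e`,
so the second line drops the dimension again. -/
theorem IsNondegenerateSubspace.finrank_inf_inf_orthogonalTo [FiniteDimensional K V]
    {W : Submodule K V} (hW : Ψ.IsNondegenerateSubspace W) {p p' : Ψ.NondegenerateLine}
    (hne : p ≠ p') (hp : p.generator ∈ W) (hp' : p'.generator ∈ W) :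
    Module.finrank K (W ⊓ Ψ.orthogonalTo p.generator ⊓ Ψ.orthogonalTo p'.generator :
      Submodule K V) + 2 = Module.finrank K W := by
  have h1 := Ψ.finrank_inf_orthogonalTo W hp p.form_generator_self
  set c := Ψ.form p'.generator p.generator / Ψ.form p.generator p.generator with hc
  set e := p'.generator - c • p.generator with he
  have he0 : e ≠ 0 := fun h =>
    hne (NondegenerateLine.eq_of_generator_eq_smul (sub_eq_zero.1 h)).symm
  have heW : e ∈ W ⊓ Ψ.orthogonalTo p.generator := by
    refine ⟨W.sub_mem hp' (W.smul_mem _ hp), ?_⟩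
    change Ψ.form e _ = 0
    rw [he, map_sub, LinearMap.sub_apply, map_smul, LinearMap.smul_apply, smul_eq_mul, hc,
      div_mul_cancel₀ _ p.form_generator_self, sub_self]
  obtain ⟨w, hw, hew⟩ : ∃ w ∈ W ⊓ Ψ.orthogonalTo p.generator, Ψ.form e w ≠ 0 := by
    by_contra! h
    exact he0 (hW.inf_orthogonalTo hp p.form_generator_self e heW h)
  have hwp : Ψ.form w p.generator = 0 := hw.2
  have hwp' : Ψ.form w p'.generator ≠ 0 := by
    intro h
    refine hew (Ψ.form_eq_zero_comm.1 ?_)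
    rw [he, map_sub, map_smulₛₗ, hwp, h, smul_zero, sub_zero]
  have h2 := Ψ.finrank_inf_orthogonalTo _ hw hwp'
  omega

/-! ### Degrees and spectral gap of the links -/

theorem finite_nondegenerateLine [Finite K] [FiniteDimensional K V] :
    Finite Ψ.NondegenerateLine :=
  have : Finite V := Module.finite_of_finite K
  Subtype.finite

/-- Lower bound for the number of nondegenerate lines in a nondegenerate subspace. -/
theorem IsNondegenerateSubspace.le_card_lines [Finite K] [FiniteDimensional K V]
    {q : ℕ} (hq : Nat.card K = q ^ 2) {l : ℕ} {W : Submodule K V}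
    (hW : Ψ.IsNondegenerateSubspace W) (hl : Module.finrank K W = l) :
    (q : ℤ) ^ (2 * l) - (-1) ^ l * q ^ l ≤
      q * (q + 1) * Nat.card {p : Ψ.NondegenerateLine // p.generator ∈ W} := by
  classical
  have : Finite V := Module.finite_of_finite K
  have : Finite Ψ.NondegenerateLine := finite_nondegenerateLine
  have hq1 : 1 < q := by
    have := Finite.one_lt_card (α := K)
    rw [hq] at this
    by_contra! h
    interval_cases q <;> simp at this
  have hiso := hW.card_isotropic hq hl
  have hadd : Nat.card {v : W // Ψ.form v.1 v.1 = 0} + Nat.card {v : W // ¬ Ψ.form v.1 v.1 = 0} =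
      Nat.card W := by
    rw [← Nat.card_sum]
    exact Nat.card_congr (Equiv.sumCompl _)
  -- A nonisotropic vector is determined by its line and a scalar. Only a lower bound on the number
  -- of lines is needed, so injectivity suffices.
  have hle : Nat.card {v : W // ¬ Ψ.form v.1 v.1 = 0} ≤
      Nat.card ({p : Ψ.NondegenerateLine // p.generator ∈ W} × Kˣ) := by
    refine Nat.card_le_card_of_injective (fun v =>
      let h := NondegenerateLine.exists_smul_generator_eq v.2
      (⟨h.choose, by
        have h1 := h.choose_spec.choose_spec
        have h2 : h.choose.generator = h.choose_spec.choose⁻¹ • v.1.1 :=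
          eq_inv_smul_iff.2 h1
        rw [h2]
        exact W.smul_mem _ v.1.2⟩, h.choose_spec.choose)) ?_
    intro v w h
    have hv := (NondegenerateLine.exists_smul_generator_eq v.2).choose_spec.choose_spec
    have hw := (NondegenerateLine.exists_smul_generator_eq w.2).choose_spec.choose_spec
    refine Subtype.ext (Subtype.ext ?_)
    rw [← hv, ← hw]
    have h1 := congrArg (fun x => x.2 • x.1.1.generator) h
    exact h1
  rw [Nat.card_prod, Nat.card_units, hq] at hle
  rw [Module.natCard_eq_pow_finrank (K := K) (V := W), hl, hq, ← pow_mul] at hadd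
  set D := Nat.card {p : Ψ.NondegenerateLine // p.generator ∈ W}
  have hq2 : 1 ≤ q ^ 2 := Nat.one_le_pow _ _ (by omega)
  have hadd' : (Nat.card {v : W // Ψ.form v.1 v.1 = 0} : ℤ) +
      Nat.card {v : W // ¬ Ψ.form v.1 v.1 = 0} = q ^ (2 * l) := by exact_mod_cast hadd
  have hle' : (Nat.card {v : W // ¬ Ψ.form v.1 v.1 = 0} : ℤ) ≤ D * (q ^ 2 - 1) := by
    have := (Nat.cast_le (α := ℤ)).2 hle
    rwa [Nat.cast_mul, Nat.cast_sub hq2, Nat.cast_pow, Nat.cast_one] at this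
  have hpos : (0 : ℤ) < q - 1 := by
    have : (1 : ℤ) < q := by exact_mod_cast hq1
    linarith
  refine le_of_mul_le_mul_left ?_ hpos
  have h1 := mul_le_mul_of_nonneg_left hle' (Int.natCast_nonneg q)
  linear_combination h1 + hiso - q * hadd'

open Classical in
/-- The second eigenvalue bound for the orthogonality graph of a nondegenerate subspace `W` of
dimension `m + 2`, in terms of the form of the adjacency matrix. -/
theorem IsNondegenerateSubspace.adjacency_form_le [Finite K] [FiniteDimensional K V]
    [Fintype Ψ.NondegenerateLine]
    {q : ℕ} (hq : Nat.card K = q ^ 2) {m : ℕ} {W : Submodule K V}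
    (hW : Ψ.IsNondegenerateSubspace W) (hm : Module.finrank K W = m + 2)
    (y : Ψ.NondegenerateLine → ℤ) (hy : ∀ p, p.generator ∉ W → y p = 0) :
    (2 * q ^ m * (q ^ 2 - 1)) *
        ∑ p, ∑ p', (if p.generator ∈ W ∧ p'.generator ∈ W ∧
          Ψ.form p.generator p'.generator = 0 then y p * y p' else 0) ≤
      (2 * (q ^ 2 - 1) * q ^ (2 * m)) * ∑ p, y p ^ 2 + q ^ (2 * m) * (∑ p, y p) ^ 2 := by
  have : Finite V := Module.finite_of_finite K
  have := Fintype.ofFinite W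
  have := Fintype.ofFinite K
  have hq2 : 1 ≤ q ^ 2 := by
    rw [← hq]
    exact Nat.card_pos
  -- At the generator of a line `p` in `W`, the value of `f` is the entry `(A y) p` for the
  -- adjacency matrix `A`. Summing `f ^ 2` over all of `W` instead is an exact count, as two
  -- distinct lines always have `q ^ (2 * m)` common orthogonal vectors in `W`.
  let f : V → ℤ := fun w => ∑ p, if Ψ.form w p.generator = 0 then y p else 0
  have hcount : ∀ p p' : Ψ.NondegenerateLine, p.generator ∈ W → p'.generator ∈ W →
      ((∑ w : W, if Ψ.form w.1 p.generator = 0 ∧ Ψ.form w.1 p'.generator = 0 then 1 else 0 : ℤ)) =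
        q ^ (2 * m) + if p = p' then (q : ℤ) ^ (2 * m) * (q ^ 2 - 1) else 0 := by
    intro p p' hp hp'
    rw [Finset.sum_boole, ← Fintype.card_subtype, ← Nat.card_eq_fintype_card]
    have hc : ∀ U : Submodule K V, (∀ w, w ∈ U ↔ w ∈ W ∧ Ψ.form w p.generator = 0 ∧
        Ψ.form w p'.generator = 0) →
        Nat.card {w : W // Ψ.form w.1 p.generator = 0 ∧ Ψ.form w.1 p'.generator = 0} =
          (q ^ 2) ^ Module.finrank K U := by
      intro U hU
      rw [← hq, ← Module.natCard_eq_pow_finrank (K := K)]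
      exact Nat.card_congr
        { toFun := fun w => ⟨w.1.1, (hU _).2 ⟨w.1.2, w.2⟩⟩
          invFun := fun w => ⟨⟨w.1, ((hU _).1 w.2).1⟩, ((hU _).1 w.2).2⟩
          left_inv := fun _ => rfl
          right_inv := fun _ => rfl }
    by_cases h : p = p'
    · subst h
      rw [hc (W ⊓ Ψ.orthogonalTo p.generator) fun w => by
        rw [and_self]; rfl]
      have := Ψ.finrank_inf_orthogonalTo W hp p.form_generator_self
      rw [show Module.finrank K (W ⊓ Ψ.orthogonalTo p.generator : Submodule K V) = m + 1 by omega]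
      simp only [if_true]
      push_cast; ring
    · rw [hc (W ⊓ Ψ.orthogonalTo p.generator ⊓ Ψ.orthogonalTo p'.generator) fun w => and_assoc]
      have := hW.finrank_inf_inf_orthogonalTo h hp hp'
      rw [show Module.finrank K (W ⊓ Ψ.orthogonalTo p.generator ⊓ Ψ.orthogonalTo p'.generator :
        Submodule K V) = m by omega]
      simp only [h, if_false]
      push_cast; ring
  have hf2 : ∑ w : W, f w.1 ^ 2 =
      q ^ (2 * m) * (∑ p, y p) ^ 2 + q ^ (2 * m) * (q ^ 2 - 1) * ∑ p, y p ^ 2 := by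
    calc ∑ w : W, f w.1 ^ 2
        = ∑ w : W, ∑ p, ∑ p', y p * y p' *
          (if Ψ.form w.1 p.generator = 0 ∧ Ψ.form w.1 p'.generator = 0 then 1 else 0) := by
          refine Finset.sum_congr rfl fun w _ => ?_
          rw [sq, Finset.sum_mul_sum]
          refine Finset.sum_congr rfl fun p _ => Finset.sum_congr rfl fun p' _ => ?_
          by_cases h1 : Ψ.form w.1 p.generator = 0 <;>
            by_cases h2 : Ψ.form w.1 p'.generator = 0 <;> simp [h1, h2]
      _ = ∑ p, ∑ p', y p * y p' * ∑ w : W,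
          (if Ψ.form w.1 p.generator = 0 ∧ Ψ.form w.1 p'.generator = 0 then 1 else 0) := by
          rw [Finset.sum_comm]
          refine Finset.sum_congr rfl fun p _ => ?_
          rw [Finset.sum_comm]
          refine Finset.sum_congr rfl fun p' _ => ?_
          rw [Finset.mul_sum]
      _ = ∑ p, ∑ p', (q ^ (2 * m) * (y p * y p') +
          if p = p' then (q : ℤ) ^ (2 * m) * (q ^ 2 - 1) * (y p * y p') else 0) := by
          refine Finset.sum_congr rfl fun p _ => Finset.sum_congr rfl fun p' _ => ?_
          by_cases hp : p.generator ∈ W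
          · by_cases hp' : p'.generator ∈ W
            · rw [hcount p p' hp hp']
              split_ifs <;> ring
            · simp [hy p' hp']
          · simp [hy p hp]
      _ = _ := by
          simp only [Finset.sum_add_distrib, Finset.sum_ite_eq, Finset.mem_univ, if_true,
            ← Finset.mul_sum]
          rw [sq (∑ p, y p), Finset.sum_mul_sum]
          simp only [sq, Finset.mul_sum]
  -- Each line carries `q ^ 2 - 1` nonzero vectors, on which `f` is constant; the isotropic vectors
  -- are discarded.
  have hlow : (q ^ 2 - 1 : ℤ) * ∑ p : {p : Ψ.NondegenerateLine // p.generator ∈ W},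
      f p.1.generator ^ 2 ≤ ∑ w : W, f w.1 ^ 2 := by
    let ι : {p : Ψ.NondegenerateLine // p.generator ∈ W} × Kˣ → W := fun x =>
      ⟨(x.2 : K) • x.1.1.generator, W.smul_mem _ x.1.2⟩
    have hι : Function.Injective ι := by
      rintro ⟨⟨p, hp⟩, c⟩ ⟨⟨p', hp'⟩, c'⟩ h
      have h1 : (c : K) • p.generator = (c' : K) • p'.generator := congrArg Subtype.val h
      have h2 : p = p' := by
        refine NondegenerateLine.eq_of_generator_eq_smul (c := (c : K)⁻¹ * c') ?_
        rw [mul_smul, ← h1, inv_smul_smul₀ c.ne_zero]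
      subst h2
      have h3 : c = c' := by
        have h4 := congrArg (fun v => Ψ.form v p.generator) h1
        simp only [map_smul, LinearMap.smul_apply, smul_eq_mul] at h4
        exact Units.ext (mul_right_cancel₀ p.form_generator_self h4)
      rw [h3]
    have hfι : ∀ x, f (ι x).1 = f x.1.1.generator := by
      intro x
      refine Finset.sum_congr rfl fun p _ => ?_
      simp [ι]
    calc (q ^ 2 - 1 : ℤ) * ∑ p : {p : Ψ.NondegenerateLine // p.generator ∈ W},
          f p.1.generator ^ 2
        = ∑ x, f (ι x).1 ^ 2 := by
          rw [Fintype.sum_prod_type, Finset.mul_sum]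
          refine Finset.sum_congr rfl fun p _ => ?_
          simp only [hfι, Finset.sum_const, Finset.card_univ, nsmul_eq_mul]
          rw [← Nat.card_eq_fintype_card, Nat.card_units, hq, Nat.cast_sub hq2]
          push_cast; rfl
      _ = ∑ w ∈ Finset.univ.image ι, f w.1 ^ 2 :=
          (Finset.sum_image (f := fun w : W => f w.1 ^ 2) fun _ _ _ _ h => hι h).symm
      _ ≤ ∑ w : W, f w.1 ^ 2 :=
          Finset.sum_le_sum_of_subset_of_nonneg (Finset.subset_univ _) fun _ _ _ => sq_nonneg _
  have hA : 2 * q ^ m * ∑ p, ∑ p', (if p.generator ∈ W ∧ p'.generator ∈ W ∧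
        Ψ.form p.generator p'.generator = 0 then y p * y p' else 0) ≤
      q ^ (2 * m) * ∑ p, y p ^ 2 +
        ∑ p : {p : Ψ.NondegenerateLine // p.generator ∈ W}, f p.1.generator ^ 2 := by
    rw [← Finset.sum_subtype (p := fun p : Ψ.NondegenerateLine => p.generator ∈ W)
      (Finset.univ.filter fun p : Ψ.NondegenerateLine => p.generator ∈ W) (by simp)
      fun p => f p.generator ^ 2, Finset.sum_filter, Finset.mul_sum, Finset.mul_sum,
      ← Finset.sum_add_distrib]
    refine Finset.sum_le_sum fun p _ => ?_
    by_cases hp : p.generator ∈ W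
    · have h1 : ∑ p', (if p.generator ∈ W ∧ p'.generator ∈ W ∧
          Ψ.form p.generator p'.generator = 0 then y p * y p' else 0) = y p * f p.generator := by
        rw [Finset.mul_sum]
        refine Finset.sum_congr rfl fun p' _ => ?_
        by_cases hp' : p'.generator ∈ W
        · simp [hp, hp']
        · simp [hp', hy p' hp']
      rw [h1, if_pos hp]
      -- `2 q^m y (A y) ≤ q^(2m) y² + (A y)²` turns the bound on the norm of `A y` into one on the
      -- quadratic form.
      have := sq_nonneg ((q : ℤ) ^ m * y p - f p.generator)
      linear_combination this
    · simp [hp, hy p hp]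
  have hq0 : (0 : ℤ) ≤ q ^ 2 - 1 := by
    have : (1 : ℤ) ≤ (q : ℤ) ^ 2 := by exact_mod_cast hq2
    linarith
  have h2 := mul_le_mul_of_nonneg_left hA hq0
  rw [hf2] at hlow
  linear_combination h2 + hlow

/-- The homology of the frame complex vanishes in degree `r - 1` as soon as the spectral bound on
the links is dominated by their degrees. -/
theorem subsingleton_reducedHomology_frameComplex [Finite K] [FiniteDimensional K V]
    {q : ℕ} (hq : Nat.card K = q ^ 2) (k : Type*) [Field k] [CharZero k]
    [LinearOrder Ψ.NondegenerateLine] {r l : ℕ} (hn : Module.finrank K V = r + (l + 1))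
    (hr : (r : ℤ) * (q + 1) < q ^ (l + 1) - (-1) ^ (l + 1)) :
    Subsingleton (AbstractSimplicialComplex.reducedHomology k Ψ.frameComplex r) := by
  classical
  have : Finite Ψ.NondegenerateLine := finite_nondegenerateLine
  have := Fintype.ofFinite Ψ.NondegenerateLine
  have hq1 : (1 : ℤ) < q := by
    have h := Finite.one_lt_card (α := K)
    rw [hq] at h
    by_contra! h'
    have : q ≤ 1 := by exact_mod_cast h'
    interval_cases q <;> simp at h
  have hqpos : (0 : ℤ) < q := by linarith
  have hql : (0 : ℤ) < (q : ℤ) ^ l := pow_pos hqpos l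
  have hq2 : (0 : ℤ) < (q : ℤ) ^ 2 - 1 := by nlinarith
  -- Here `b / a = q ^ l`, the spectral bound for dimension `l + 2`. The degrees exceed `q ^ l * r`,
  -- so by integrality they are at least `d = q ^ l * r + 1`, and `a * d - b * r = a > 0`.
  refine AbstractSimplicialComplex.subsingleton_reducedHomology_of_garland k Ψ.frameComplex r
    (2 * q ^ l * (q ^ 2 - 1)) (2 * (q ^ 2 - 1) * q ^ (2 * l)) (q ^ (2 * l)) (q ^ l * r + 1)
    (by positivity) ?_ ?_ ?_
  · have : 0 < 2 * (q : ℤ) ^ l * (q ^ 2 - 1) := by positivity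
    linear_combination this
  · intro s hs hf
    obtain ⟨h1, h2⟩ := isNondegenerateSubspace_perp_and_finrank hf
    have h3 := h1.le_card_lines hq (l := l + 1) (by omega)
    simp only [isFace_insert_iff hf]
    set D := Nat.card {p : Ψ.NondegenerateLine // p.generator ∈ Ψ.perp s}
    have h4 : (q : ℤ) ^ (l + 1) * (r * (q + 1)) < q ^ (l + 1) * (q ^ (l + 1) - (-1) ^ (l + 1)) :=
      mul_lt_mul_of_pos_left hr (pow_pos hqpos _)
    have h5 : (q * (q + 1) : ℤ) * (q ^ l * r) < q * (q + 1) * D := by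
      linear_combination h4 + h3
    exact lt_of_mul_lt_mul_left h5 (by positivity)
  · intro t ht hf y hy
    obtain ⟨h1, h2⟩ := isNondegenerateSubspace_perp_and_finrank hf
    simp only [isFace_insert_iff hf] at hy
    refine le_of_eq_of_le (congrArg _ ?_) (h1.adjacency_form_le hq (m := l) (by omega) y hy)
    exact Finset.sum_congr rfl fun p _ => Finset.sum_congr rfl fun p' _ =>
      if_congr (isFace_insert_insert_iff hf) rfl rfl

end UnitaryForm

/-! ### The numerical ranges -/

theorem theorem5p5 {K : Type*} [Field K] [Finite K] (q : ℕ) (hq : Nat.card K = q ^ 2)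
    {τ : K →+* K} {V : Type*} [AddCommGroup V] [Module K V] [FiniteDimensional K V]
    (Ψ : UnitaryForm τ V) (n : ℕ) (hn : Module.finrank K V = n)
    (k : Type*) [Field k] [CharZero k] :
    (2 ≤ n → n < q + 1 → Ψ.frameComplex.IsHomologicallyConnected k ((n : ℤ) - 3)) ∧
    (3 ≤ q → 4 ≤ n → (n : ℤ) < (q : ℤ) ^ 2 - q + 4 →
      Ψ.frameComplex.IsHomologicallyConnected k ((n : ℤ) - 4)) ∧
    (3 ≤ q →
      ((n = 4 ∨ n = 5 ∨ n = 6) → n ≤ q →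
        Ψ.frameComplex.IsHomologicallyConnected k ((n : ℤ) - 3)) ∧
      ((n = 4 ∨ n = 5 ∨ n = 6) → q < n →
        Ψ.frameComplex.IsHomologicallyConnected k ((n : ℤ) - 4)) ∧
      (7 ≤ n → Ψ.frameComplex.IsHomologicallyConnected k ((n / 2 : ℕ) : ℤ))) := by
  have hq1 : 2 ≤ q := by
    have h := Finite.one_lt_card (α := K)
    rw [hq] at h
    by_contra! h'
    interval_cases q <;> simp at h
  have hq1' : (2 : ℤ) ≤ q := by exact_mod_cast hq1
  -- The condition `m + 1 < n` forces `r < n`, so that `l` is a natural number.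
  have key : ∀ m : ℤ, (∀ r l : ℕ, n = r + (l + 1) → (r : ℤ) - 1 ≤ m →
      (r : ℤ) * (q + 1) < q ^ (l + 1) - (-1) ^ (l + 1)) → m + 1 < n →
      Ψ.frameComplex.IsHomologicallyConnected k m := by
    intro m hm hmn _ r hr
    obtain ⟨l, hl⟩ : ∃ l, n = r + (l + 1) := ⟨n - r - 1, by omega⟩
    exact UnitaryForm.subsingleton_reducedHomology_frameComplex hq k (hn.trans hl) (hm r l hl hr)
  have hpow : ∀ a b : ℕ, a ≤ b → (q : ℤ) ^ a ≤ q ^ b := fun a b h =>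
    pow_le_pow_right₀ (by linarith) h
  have hsign : ∀ j : ℕ, (-1 : ℤ) ^ j ≤ 1 := by
    intro j
    rcases neg_one_pow_eq_or ℤ j with h | h <;> simp [h]
  have hi : 2 ≤ n → n < q + 1 → Ψ.frameComplex.IsHomologicallyConnected k ((n : ℤ) - 3) := by
    intro h2 hnq
    refine key _ (fun r l hl hr => ?_) (by omega)
    have h1 := hpow 2 (l + 1) (by omega)
    have h2 := hsign (l + 1)
    have h3 : (r : ℤ) ≤ q - 2 := by omega
    nlinarith
  have hii : 3 ≤ q → 4 ≤ n → (n : ℤ) < (q : ℤ) ^ 2 - q + 4 →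
      Ψ.frameComplex.IsHomologicallyConnected k ((n : ℤ) - 4) := by
    intro h3 h4 hnq
    refine key _ (fun r l hl hr => ?_) (by omega)
    have hr' : (r : ℤ) ≤ q ^ 2 - q := by
      have : (r : ℤ) ≤ n - 3 := by omega
      linarith
    have h6 : (r : ℤ) * (q + 1) ≤ (q ^ 2 - q) * (q + 1) :=
      mul_le_mul_of_nonneg_right hr' (by linarith)
    -- The extreme case is `l + 1 = 3`, where the odd sign gives `q ^ 3 + 1`, against `(q ^ 2 - q) *
    -- (q + 1) = q ^ 3 - q`.
    have h7 : (q : ℤ) ^ 3 + 1 ≤ q ^ (l + 1) - (-1) ^ (l + 1) := by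
      rcases (show l + 1 = 3 ∨ 4 ≤ l + 1 by omega) with h | h
      · rw [h]; norm_num
      · have h1 := hpow 4 (l + 1) h
        have h2 := hsign (l + 1)
        have h5 : (8 : ℤ) ≤ q ^ 3 := pow_le_pow_left₀ (by norm_num) hq1' 3
        nlinarith
    nlinarith
  refine ⟨hi, hii, fun hq3 => ⟨fun h hnq => hi (by omega) (by omega), fun h hnq => ?_, ?_⟩⟩
  · refine hii hq3 (by omega) ?_
    have : (3 : ℤ) ≤ q := by exact_mod_cast hq3
    have : (n : ℤ) ≤ 6 := by omega
    nlinarith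
  · intro h7
    refine key _ (fun r l hl hr => ?_) (by omega)
    have hq3' : (3 : ℤ) ≤ q := by exact_mod_cast hq3
    -- From `r ≤ n / 2 + 1` and `n = r + l + 1`; then `7 ≤ n ≤ 2 * l + 4` gives `2 ≤ l`.
    have hrl : r ≤ l + 3 := by omega
    have hl2 : 2 ≤ l := by omega
    have hbase : ∀ j : ℕ, 2 ≤ j → ((j : ℤ) + 3) * (q + 1) < q ^ (j + 1) - (-1) ^ (j + 1) := by
      intro j hj
      rcases (show j = 2 ∨ 3 ≤ j by omega) with rfl | h
      · push_cast
        nlinarith [mul_self_nonneg ((q : ℤ) - 3)]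
      · have h1 := hsign (j + 1)
        -- The extra `1` absorbs the alternating sign, which would otherwise obstruct the induction.
        have h2 : ((j : ℤ) + 3) * (q + 1) + 1 < q ^ (j + 1) := by
          clear h1 hj
          induction j, h using Nat.le_induction with
          | base => push_cast; nlinarith [mul_self_nonneg ((q : ℤ) - 3), mul_self_nonneg ((q : ℤ) ^ 2 - 9)]
          | succ j hj ih =>
            rw [pow_succ]
            have hj' : (3 : ℤ) ≤ j := by exact_mod_cast hj
            push_cast
            nlinarith [mul_nonneg (show (0 : ℤ) ≤ j by linarith) (show (0 : ℤ) ≤ q - 3 by linarith)]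
        linarith
    have h8 : (r : ℤ) * (q + 1) ≤ (l + 3) * (q + 1) :=
      mul_le_mul_of_nonneg_right (by exact_mod_cast hrl) (by linarith)
    exact h8.trans_lt (hbase l hl2)
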